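/- Let $(S,\mathfrak A,\mu)$ and $(T,\mathfrak B,\nu)$ be $\sigma$-finite measure spaces. A function $\Phi:S\times T\to\mathbb C$ belongs to $\mathfrak M(S\times T)$ (is a discrete Schur multiplier) if for every bounded linear operator $A:\ell^2(T)\to\ell^2(S)$ with matrix $\{a(s,t)\}_{(s,t)\in S\times T}$ the matrix $\{\Phi(s,t)a(s,t)\}_{(s,t)\in S\times T}$ is also the matrix of a bounded linear operator $M_\Phi A:\ell^2(T)\to\ell^2(S)$; $\|\Phi\|_{\mathfrak M(S\times T)}$ denotes the norm of the transformer $A\mapsto M_\Phi A$ with respect to the operator norms. For $h\in L^2(\mu\times\nu)$ let $\mathcal I_h:L^2(\nu)\to L^2(\mu)$ be the integral operator $(\mathcal I_hf)(s)=\int_T h(s,t)f(t)\,d\nu(t)$, and let $\|\cdot\|_{\boldsymbol S_1}$ be the trace norm, with $\|\mathcal I_h\|_{\boldsymbol S_1}=\infty$ if $\mathcal I_h$ is not of trace class (in particular if $h\notin L^2(\mu\times\nu)$). A $\mu\times\nu$-measurable function $\Phi:S\times T\to\mathbb C$ belongs to $\mathfrak M(\mu,\nu)$ if for every $h\in L^2(\mu\times\nu)$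 for which $\mathcal I_h$ is of trace class, $\mathcal I_{\Phi h}$ is of trace class; $\|\Phi\|_{\mathfrak M(\mu,\nu)}$ is the smallest constant $c\ge0$ such that $\|\mathcal I_{\Phi h}\|_{\boldsymbol S_1}\le c\,\|\mathcal I_h\|_{\boldsymbol S_1}$ for all $h\in L^2(\mu\times\nu)$. Let $\Phi\in\mathfrak M(S\times T)$ be measurable with respect to $\mu\times\nu$ (that is, equal $\mu\times\nu$-almost everywhere to an $\mathfrak A\otimes\mathfrak B$-measurable function). Then there are functions $\varphi_n\in L^\infty(\mu)$ and $\psi_n\in L^\infty(\nu)$, $n\ge1$, such that $$\Phi(s,t)=\sum_{n=1}^\infty\varphi_n(s)\psi_n(t)\quad\text{for }\mu\times\nu\text{-almost all }(s,t)\in S\times T,$$ $$\sum_{n=1}^\infty|\varphi_n|^2\le\|\Phi\|_{\mathfrak M(S\times T)}\quad\mu\text{-almost everywhere},\qquad \sum_{n=1}^\infty|\psi_n|^2\le\|\Phi\|_{\mathfrak M(S\times T)}\quad\nu\text{-almost everywhere}.$$ Moreover, $\Phi\in\mathfrak M(\mu,\nu)$ and $\|\Phi\|_{\mathfrak M(\mu,\nu)}\le\|\Phi\|_{\mathfrak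 M(S\times T)}$. -/

import Mathlib

open MeasureTheory
open scoped ENNReal InnerProductSpace

noncomputable section

namespace SchurMult

universe u v

/-! ### Discrete Schur multipliers -/

/-- The Hilbert space `ℓ²(X)` of square summable complex functions on an arbitrary set `X`. -/
abbrev EllTwo (X : Type u) : Type u := lp (fun _ : X => ℂ) 2

/-- The entry `a(s,t) = (A δ_t)(s)` of the matrix of an operator `A : ℓ²(T) → ℓ²(S)`. -/
def matrixEntry {S : Type u} {T : Type v} (A : EllTwo T →L[ℂ] EllTwo S) (s : S) (t : T) : ℂ :=
  letI := Classical.decEq T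
  (A (lp.single (E := fun _ : T => ℂ) 2 t (1 : ℂ)) : EllTwo S) s

/-- `B = M_Φ A`: the bounded operator `B` has the matrix `Φ(s,t) a(s,t)`,
where `a(s,t)` is the matrix of `A`. -/
def IsSchurProduct {S : Type u} {T : Type v} (Φ : S × T → ℂ)
    (A B : EllTwo T →L[ℂ] EllTwo S) : Prop :=
  ∀ s t, matrixEntry B s t = Φ (s, t) * matrixEntry A s t

/-- A bounded operator is determined by its matrix. -/
theorem matrixEntry_ext {S : Type u} {T : Type v} {A B : EllTwo T →L[ℂ] EllTwo S}
    (h : ∀ s t, matrixEntry A s t = matrixEntry B s t) : A = B := by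
  classical
  have key : ∀ t : T, ∀ c : ℂ, A (lp.single (E := fun _ : T => ℂ) 2 t c) =
      B (lp.single (E := fun _ : T => ℂ) 2 t c) := by
    intro t c
    have h1 : lp.single (E := fun _ : T => ℂ) 2 t c =
        c • lp.single (E := fun _ : T => ℂ) 2 t (1 : ℂ) := by
      rw [← lp.single_smul]; simp
    rw [h1, map_smul, map_smul]
    congr 1
    ext s
    have := h s t
    unfold matrixEntry at this
    convert this using 4
  ext1 f
  have hf := lp.hasSum_single (E := fun _ : T => ℂ) (p := 2) (by norm_num) f
  have hA := hf.mapL A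
  have hB := hf.mapL B
  simp only [key] at hA
  exact hA.unique hB

/-- Hence `M_Φ A` is unique. -/
theorem IsSchurProduct.unique {S : Type u} {T : Type v} {Φ : S × T → ℂ}
    {A B B' : EllTwo T →L[ℂ] EllTwo S} (h : IsSchurProduct Φ A B) (h' : IsSchurProduct Φ A B') :
    B = B' :=
  matrixEntry_ext fun s t => (h s t).trans (h' s t).symm

/-- `Φ ∈ 𝔐(S × T)`: for every bounded `A : ℓ²(T) → ℓ²(S)` the matrix `Φ(s,t) a(s,t)` is the matrix
of a bounded operator `ℓ²(T) → ℓ²(S)`. -/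
def IsDiscreteSchurMultiplier {S : Type u} {T : Type v} (Φ : S × T → ℂ) : Prop :=
  ∀ A : EllTwo T →L[ℂ] EllTwo S, ∃ B : EllTwo T →L[ℂ] EllTwo S, IsSchurProduct Φ A B

/-- `‖Φ‖_{𝔐(S × T)}`: the norm of the transformer `A ↦ M_Φ A`, that is, the least `c ≥ 0` such that
`‖M_Φ A‖ ≤ c ‖A‖` for all bounded `A`. -/
def discreteSchurNorm {S : Type u} {T : Type v} (Φ : S × T → ℂ) : ℝ :=
  sInf {c : ℝ | 0 ≤ c ∧ ∀ A B : EllTwo T →L[ℂ] EllTwo S, IsSchurProduct Φ A B → ‖B‖ ≤ c * ‖A‖}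

/-! ### Trace norm -/

section TraceNorm

variable {E : Type u} {F : Type v}
  [NormedAddCommGroup E] [InnerProductSpace ℂ E] [CompleteSpace E]
  [NormedAddCommGroup F] [InnerProductSpace ℂ F] [CompleteSpace F]

/-- `|A| = (A* A)^{1/2}` for a bounded operator between Hilbert spaces. -/
def opAbs (A : E →L[ℂ] F) : E →L[ℂ] E :=
  CFC.sqrt ((ContinuousLinearMap.adjoint A) ∘L A)

/-- The sum `∑ ⟨|A| e_i, e_i⟩ ∈ [0, ∞]` over a Hilbert basis `e`. -/
def traceNormOn {ι : Type*} (e : HilbertBasis ι ℂ E) (A : E →L[ℂ] F) : ℝ≥0∞ :=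
  ∑' i, ENNReal.ofReal (RCLike.re ⟪e i, opAbs A (e i)⟫_ℂ)

/-- The trace norm `‖A‖_{S₁} = tr |A| ∈ [0, ∞]`, computed in some Hilbert basis of the domain; it
does not depend on the basis, see `traceNorm_eq`. The operator `A` is of trace class if and only if
`‖A‖_{S₁} < ∞`. -/
def traceNorm (A : E →L[ℂ] F) : ℝ≥0∞ :=
  traceNormOn (exists_hilbertBasis ℂ E).choose_spec.choose A

theorem parseval_enorm {ι : Type*} (e : HilbertBasis ι ℂ E) (x : E) :
    ∑' i, ‖⟪e i, x⟫_ℂ‖ₑ ^ 2 = ‖x‖ₑ ^ 2 := by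
  have h := e.hasSum_inner_mul_inner x x
  have h2 : HasSum (fun i => ‖⟪e i, x⟫_ℂ‖ ^ 2) (‖x‖ ^ 2) := by
    have h3 := Complex.hasSum_re h
    convert h3 using 1
    · ext i
      rw [← inner_conj_symm x (e i), RCLike.conj_mul]
      norm_cast
    · rw [inner_self_eq_norm_sq_to_K]
      norm_cast
  have h4 := ENNReal.ofReal_tsum_of_nonneg (fun i => by positivity) h2.summable
  rw [h2.tsum_eq, ENNReal.ofReal_pow (norm_nonneg _), ofReal_norm] at h4
  rw [h4]
  refine tsum_congr fun i => ?_
  rw [ENNReal.ofReal_pow (norm_nonneg _), ofReal_norm]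

theorem traceNormOn_eq {ι κ : Type*} (e : HilbertBasis ι ℂ E) (f : HilbertBasis κ ℂ E)
    (A : E →L[ℂ] F) : traceNormOn e A = traceNormOn f A := by
  set Q : E →L[ℂ] E := CFC.sqrt (opAbs A) with hQ
  have hQQ : Q * Q = opAbs A := CFC.sqrt_mul_sqrt_self _ (CFC.sqrt_nonneg _)
  have hQsa : IsSelfAdjoint Q := (CFC.sqrt_nonneg (opAbs A)).isSelfAdjoint
  have hsym : ∀ x y : E, ⟪x, Q y⟫_ℂ = ⟪Q x, y⟫_ℂ := fun x y => by
    rw [← ContinuousLinearMap.adjoint_inner_left, hQsa.adjoint_eq]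
  have hterm : ∀ x : E, ENNReal.ofReal (RCLike.re ⟪x, opAbs A x⟫_ℂ) = ‖Q x‖ₑ ^ 2 := fun x => by
    rw [← hQQ, show (Q * Q) x = Q (Q x) from rfl, hsym, inner_self_eq_norm_sq,
      ENNReal.ofReal_pow (norm_nonneg _), ofReal_norm]
  unfold traceNormOn
  simp only [hterm]
  calc ∑' i, ‖Q (e i)‖ₑ ^ 2 = ∑' i, ∑' j, ‖⟪f j, Q (e i)⟫_ℂ‖ₑ ^ 2 := by
        simp only [parseval_enorm f]
    _ = ∑' j, ∑' i, ‖⟪f j, Q (e i)⟫_ℂ‖ₑ ^ 2 := ENNReal.tsum_comm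
    _ = ∑' j, ∑' i, ‖⟪e i, Q (f j)⟫_ℂ‖ₑ ^ 2 := by
        refine tsum_congr fun j => tsum_congr fun i => ?_
        rw [hsym, ← inner_conj_symm, RCLike.enorm_conj]
    _ = ∑' j, ‖Q (f j)‖ₑ ^ 2 := by simp only [parseval_enorm e]

/-- The trace norm may be computed in any Hilbert basis. -/
theorem traceNorm_eq {ι : Type*} (e : HilbertBasis ι ℂ E) (A : E →L[ℂ] F) :
    traceNorm A = ∑' i, ENNReal.ofReal (RCLike.re ⟪e i, opAbs A (e i)⟫_ℂ) :=
  traceNormOn_eq _ e A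

end TraceNorm

/-! ### Integral operators -/

section Integral

variable {S : Type u} {T : Type v} [MeasurableSpace S] [MeasurableSpace T]

theorem ae_memLp_section {μ : Measure S} {ν : Measure T} [SFinite μ] [SFinite ν] {h : S × T → ℂ}
    (hh : MemLp h 2 (μ.prod ν)) : ∀ᵐ s ∂μ, MemLp (fun t => h (s, t)) 2 ν := by
  have h1 : Integrable (fun z => ‖h z‖ ^ 2) (μ.prod ν) := (memLp_two_iff_integrable_sq_norm hh.1).1 hh
  filter_upwards [h1.prod_right_ae, hh.1.prodMk_left] with s hs hs'
  exact (memLp_two_iff_integrable_sq_norm hs').2 hs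

theorem eLpNorm_two_sq {X : Type*} [MeasurableSpace X] (m : Measure X) (g : X → ℂ) :
    eLpNorm g 2 m ^ 2 = ∫⁻ x, ‖g x‖ₑ ^ 2 ∂m := by
  rw [eLpNorm_eq_lintegral_rpow_enorm_toReal (by norm_num) (by norm_num)]
  rw [← ENNReal.rpow_natCast, ← ENNReal.rpow_mul]
  norm_num

theorem enorm_integral_mul_sq_le (m : Measure T) {g f : T → ℂ} (hg : AEStronglyMeasurable g m)
    (hf : AEStronglyMeasurable f m) :
    ‖∫ t, g t * f t ∂m‖ₑ ^ 2 ≤ (∫⁻ t, ‖g t‖ₑ ^ 2 ∂m) * eLpNorm f 2 m ^ 2 := by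
  have h1 : ‖∫ t, g t * f t ∂m‖ₑ ≤ eLpNorm g 2 m * eLpNorm f 2 m := by
    calc ‖∫ t, g t * f t ∂m‖ₑ ≤ ∫⁻ t, ‖g t * f t‖ₑ ∂m := enorm_integral_le_lintegral_enorm _
      _ = ∫⁻ t, ((fun t => ‖g t‖ₑ) * (fun t => ‖f t‖ₑ)) t ∂m := by simp [enorm_mul]
      _ ≤ _ := ENNReal.lintegral_mul_le_Lp_mul_Lq m Real.HolderConjugate.two_two hg.enorm hf.enorm
      _ = _ := by
        rw [eLpNorm_eq_lintegral_rpow_enorm_toReal (by norm_num) (by norm_num),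
          eLpNorm_eq_lintegral_rpow_enorm_toReal (by norm_num) (by norm_num)]
        simp
  calc _ ≤ (eLpNorm g 2 m * eLpNorm f 2 m) ^ 2 := by gcongr
    _ = _ := by rw [mul_pow, eLpNorm_two_sq m g]

theorem eLpNorm_kernel_le {μ : Measure S} {ν : Measure T} [SFinite μ] [SFinite ν] {h : S × T → ℂ}
    (hh : MemLp h 2 (μ.prod ν)) {f : T → ℂ} (hf : MemLp f 2 ν) :
    eLpNorm (fun s => ∫ t, h (s, t) * f t ∂ν) 2 μ ≤ eLpNorm h 2 (μ.prod ν) * eLpNorm f 2 ν := by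
  rw [← ENNReal.pow_le_pow_left_iff two_ne_zero, mul_pow, eLpNorm_two_sq, eLpNorm_two_sq (μ.prod ν),
    lintegral_prod _ (hh.1.enorm.pow_const 2)]
  calc _ ≤ ∫⁻ s, (∫⁻ t, ‖h (s, t)‖ₑ ^ 2 ∂ν) * eLpNorm f 2 ν ^ 2 ∂μ := by
        refine lintegral_mono_ae ?_
        filter_upwards [hh.1.prodMk_left] with s hs
        exact enorm_integral_mul_sq_le ν hs hf.1
    _ = _ := lintegral_mul_const'' _ (hh.1.enorm.pow_const 2).lintegral_prod_right'

theorem memLp_kernel {μ : Measure S} {ν : Measure T} [SFinite μ] [SFinite ν] {h : S × T → ℂ}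
    (hh : MemLp h 2 (μ.prod ν)) {f : T → ℂ} (hf : MemLp f 2 ν) :
    MemLp (fun s => ∫ t, h (s, t) * f t ∂ν) 2 μ :=
  ⟨(hh.1.mul hf.1.comp_snd).integral_prod_right',
    (eLpNorm_kernel_le hh hf).trans_lt (ENNReal.mul_lt_top hh.2 hf.2)⟩

/-- The integral operator `I_h : L²(ν) → L²(μ)`, `(I_h f)(s) = ∫ h(s,t) f(t) dν(t)`, with a kernel
`h ∈ L²(μ × ν)`. -/
def integralOperator (μ : Measure S) (ν : Measure T) [SFinite μ] [SFinite ν] (h : S × T → ℂ)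
    (hh : MemLp h 2 (μ.prod ν)) : Lp ℂ 2 ν →L[ℂ] Lp ℂ 2 μ :=
  LinearMap.mkContinuous
    { toFun := fun f => (memLp_kernel hh (Lp.memLp f)).toLp (fun s => ∫ t, h (s, t) * f t ∂ν)
      map_add' := fun f g => by
        rw [← MemLp.toLp_add]
        refine MemLp.toLp_congr _ _ ?_
        filter_upwards [ae_memLp_section hh] with s hs
        simp only [Pi.add_apply]
        refine Eq.trans ?_ (integral_add (hs.integrable_mul (Lp.memLp f))
          (hs.integrable_mul (Lp.memLp g)))
        refine integral_congr_ae ?_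
        filter_upwards [Lp.coeFn_add f g] with t ht
        simp only [ht, Pi.add_apply, mul_add]
      map_smul' := fun c f => by
        rw [RingHom.id_apply, ← MemLp.toLp_const_smul]
        refine MemLp.toLp_congr _ _ (Filter.Eventually.of_forall fun s => ?_)
        simp only [Pi.smul_apply]
        rw [← integral_smul]
        refine integral_congr_ae ?_
        filter_upwards [Lp.coeFn_smul c f] with t ht
        simp only [ht, Pi.smul_apply, smul_eq_mul]
        ring }
    (eLpNorm h 2 (μ.prod ν)).toReal
    (fun f => by
      simp only [LinearMap.coe_mk, AddHom.coe_mk]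
      rw [Lp.norm_toLp, Lp.norm_def, ← ENNReal.toReal_mul]
      exact ENNReal.toReal_mono (ENNReal.mul_lt_top hh.2 (Lp.memLp f).2).ne
        (eLpNorm_kernel_le hh (Lp.memLp f)))

theorem integralOperator_apply (μ : Measure S) (ν : Measure T) [SFinite μ] [SFinite ν]
    (h : S × T → ℂ) (hh : MemLp h 2 (μ.prod ν)) (f : Lp ℂ 2 ν) :
    integralOperator μ ν h hh f =ᵐ[μ] fun s => ∫ t, h (s, t) * f t ∂ν :=
  MemLp.coeFn_toLp (memLp_kernel hh (Lp.memLp f))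

/-! ### Schur multipliers with respect to measures -/

open Classical in
/-- `‖I_h‖_{S₁} ∈ [0, ∞]`, which is `∞` when `I_h` is not of trace class; in particular it is `∞`
when `h ∉ L²(μ × ν)`. -/
def kernelTraceNorm (μ : Measure S) (ν : Measure T) [SFinite μ] [SFinite ν] (h : S × T → ℂ) :
    ℝ≥0∞ :=
  if hh : MemLp h 2 (μ.prod ν) then traceNorm (integralOperator μ ν h hh) else ∞

/-- `Φ ∈ 𝔐(μ, ν)`: the function `Φ` is `μ × ν`-measurable, and if `h ∈ L²(μ × ν)` and `I_h` is of
trace class, then `I_{Φ h}` is of trace class. -/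
def IsSchurMultiplier (μ : Measure S) (ν : Measure T) [SFinite μ] [SFinite ν] (Φ : S × T → ℂ) :
    Prop :=
  AEMeasurable Φ (μ.prod ν) ∧ ∀ h : S × T → ℂ, MemLp h 2 (μ.prod ν) →
    kernelTraceNorm μ ν h < ∞ → kernelTraceNorm μ ν (fun z => Φ z * h z) < ∞

/-- `‖Φ‖_{𝔐(μ, ν)}`: the least `c` with `‖I_{Φ h}‖_{S₁} ≤ c ‖I_h‖_{S₁}` for all `h ∈ L²(μ × ν)`
(with the value `∞` if there is no finite `c`). -/
def schurNorm (μ : Measure S) (ν : Measure T) [SFinite μ] [SFinite ν] (Φ : S × T → ℂ) : ℝ≥0∞ :=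
  sInf {c : ℝ≥0∞ | ∀ h : S × T → ℂ, MemLp h 2 (μ.prod ν) →
    kernelTraceNorm μ ν (fun z => Φ z * h z) ≤ c * kernelTraceNorm μ ν h}

end Integral

end SchurMult

end

/-!
By the closed graph theorem the transformer `A ↦ M_Φ A` is bounded, so every finite matrix
`(Φ(s i, t j))` with distinct points is a Schur multiplier of norm at most `‖Φ‖ = ‖Φ‖_{𝔐(S × T)}`.
These matrices form a closed convex set, which therefore also contains the matrices of averages of
`Φ` over products of cells of two partitions. A Hahn–Banach separation argument represents a finite
Schur multiplier as `⟪x i, y j⟫` with `‖x i‖², ‖y j‖² ≤ ‖Φ‖`. Over finite measures this gives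
`∫_{E × G} Φ = ⟪X 1_E, Y 1_G⟫` for unions `E`, `G` of cells, and an ultralimit over finite
partitions gives operators `X`, `Y` into one Hilbert space which work for all measurable `E`, `G`.
Since `X* Y = I_Φ` is Hilbert–Schmidt, only a separable part of that space matters, and expanding in
an orthonormal sequence produces `φ n`, `ψ n`. The bound on the trace norm follows from
`I_{Φ h} = ∑ n, φ n I_h ψ n`: the polar decomposition writes each term of the trace as an inner
product of Hilbert–Schmidt operators, to which the Cauchy–Schwarz inequality applies.
-/

noncomputable section

namespace SchurMult

universe u v

/-! ### The discrete transformer and its finite submatrices -/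

section Discrete

variable {S : Type u} {T : Type v} {Φ : S × T → ℂ}

theorem matrixEntry_def [DecidableEq T] (A : EllTwo T →L[ℂ] EllTwo S) (s : S) (t : T) :
    matrixEntry A s t = A (lp.single (E := fun _ : T => ℂ) 2 t (1 : ℂ)) s := by
  rw [matrixEntry, Subsingleton.elim (Classical.decEq T) ‹_›]

theorem matrixEntry_add (A B : EllTwo T →L[ℂ] EllTwo S) (s : S) (t : T) :
    matrixEntry (A + B) s t = matrixEntry A s t + matrixEntry B s t := rfl

theorem matrixEntry_smul (c : ℂ) (A : EllTwo T →L[ℂ] EllTwo S) (s : S) (t : T) :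
    matrixEntry (c • A) s t = c * matrixEntry A s t := rfl

theorem continuous_matrixEntry (s : S) (t : T) :
    Continuous fun A : EllTwo T →L[ℂ] EllTwo S => matrixEntry A s t :=
  (lp.evalCLM ℂ (fun _ : S => ℂ) 2 s).continuous.comp
    (ContinuousLinearMap.apply ℂ (EllTwo S) _).continuous

/-- The transformer `A ↦ M_Φ A` of a discrete Schur multiplier, which is bounded by the closed
graph theorem. -/
def schurTransformer (hΦ : IsDiscreteSchurMultiplier Φ) :
    (EllTwo T →L[ℂ] EllTwo S) →L[ℂ] (EllTwo T →L[ℂ] EllTwo S) :=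
  .ofSeqClosedGraph
    (g :=
      { toFun := fun A => (hΦ A).choose
        map_add' := fun A B => (hΦ (A + B)).choose_spec.unique fun s t => by
          rw [matrixEntry_add, matrixEntry_add, (hΦ A).choose_spec s t,
            (hΦ B).choose_spec s t, mul_add]
        map_smul' := fun c A => (hΦ (c • A)).choose_spec.unique fun s t => by
          rw [RingHom.id_apply, matrixEntry_smul, matrixEntry_smul, (hΦ A).choose_spec s t,
            mul_left_comm] })
    fun A X Y hX hY => IsSchurProduct.unique (fun s t =>
      tendsto_nhds_unique (((continuous_matrixEntry s t).tendsto Y).comp hY)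
        (((((continuous_matrixEntry s t).tendsto X).comp hX).const_mul (Φ (s, t))).congr
          fun n => ((hΦ (A n)).choose_spec s t).symm)) (hΦ X).choose_spec

theorem isSchurProduct_schurTransformer (hΦ : IsDiscreteSchurMultiplier Φ)
    (A : EllTwo T →L[ℂ] EllTwo S) : IsSchurProduct Φ A (schurTransformer hΦ A) :=
  (hΦ A).choose_spec

theorem discreteSchurNorm_nonneg (Φ : S × T → ℂ) : 0 ≤ discreteSchurNorm Φ :=
  Real.sInf_nonneg fun _ h => h.1

theorem IsSchurProduct.norm_le (hΦ : IsDiscreteSchurMultiplier Φ)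
    {A B : EllTwo T →L[ℂ] EllTwo S} (h : IsSchurProduct Φ A B) :
    ‖B‖ ≤ discreteSchurNorm Φ * ‖A‖ := by
  have hbound : ‖schurTransformer hΦ‖ ∈ {c : ℝ | 0 ≤ c ∧ ∀ A B : EllTwo T →L[ℂ] EllTwo S,
      IsSchurProduct Φ A B → ‖B‖ ≤ c * ‖A‖} :=
    ⟨ContinuousLinearMap.opNorm_nonneg _, fun A B hAB =>
      hAB.unique (isSchurProduct_schurTransformer hΦ A) ▸ (schurTransformer hΦ).le_opNorm A⟩
  have hclosed : IsClosed {c : ℝ | 0 ≤ c ∧ ∀ A B : EllTwo T →L[ℂ] EllTwo S,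
      IsSchurProduct Φ A B → ‖B‖ ≤ c * ‖A‖} := by
    simp only [Set.ofPred_and, Set.ofPred_forall]
    exact isClosed_Ici.inter <| isClosed_iInter fun A => isClosed_iInter fun B =>
      isClosed_iInter fun _ => isClosed_le continuous_const (continuous_id.mul continuous_const)
  exact (hclosed.csInf_mem ⟨_, hbound⟩ ⟨0, fun _ hc => hc.1⟩).2 A B h

end Discrete

section PointIsometry

variable {X : Type u} {ι : Type*} {s : ι → X}

theorem inner_single_one [DecidableEq X] (x : X) (f : EllTwo X) :
    ⟪lp.single (E := fun _ : X => ℂ) 2 x (1 : ℂ), f⟫_ℂ = f x := by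
  rw [lp.inner_single_left, RCLike.inner_apply, map_one, mul_one]

theorem orthonormal_single [DecidableEq X] (hs : Function.Injective s) :
    Orthonormal ℂ fun i => lp.single (E := fun _ : X => ℂ) 2 (s i) (1 : ℂ) := by
  classical
  rw [orthonormal_iff_ite]
  intro i j
  rw [inner_single_one, lp.single_apply, Pi.single_apply]
  simp only [hs.eq_iff]

variable [Fintype ι]

open Classical in
/-- The isometric embedding of `ℂ^ι` into `ℓ²(X)` that puts the coordinates at the points `s i`. -/
def pointIsometry (hs : Function.Injective s) : EuclideanSpace ℂ ι →ₗᵢ[ℂ] EllTwo X :=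
  ((EuclideanSpace.basisFun ι ℂ).toBasis.constr ℂ
      fun i => lp.single (E := fun _ : X => ℂ) 2 (s i) (1 : ℂ)).isometryOfOrthonormal
    (v := (EuclideanSpace.basisFun ι ℂ).toBasis)
    (by rw [OrthonormalBasis.coe_toBasis]; exact (EuclideanSpace.basisFun ι ℂ).orthonormal)
    (by
      convert orthonormal_single hs with i
      exact Module.Basis.constr_basis _ _ _ i)

theorem pointIsometry_single [DecidableEq ι] [DecidableEq X] (hs : Function.Injective s) (i : ι) :
    pointIsometry hs (EuclideanSpace.single i 1) =
      lp.single (E := fun _ : X => ℂ) 2 (s i) (1 : ℂ) := by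
  have h := (EuclideanSpace.basisFun ι ℂ).toBasis.constr_basis ℂ
    (fun i => lp.single (E := fun _ : X => ℂ) 2 (s i) (1 : ℂ)) i
  rw [OrthonormalBasis.coe_toBasis, EuclideanSpace.basisFun_apply] at h
  rw [pointIsometry, LinearMap.coe_isometryOfOrthonormal]
  convert h

theorem adjoint_pointIsometry_apply (hs : Function.Injective s) (f : EllTwo X) (i : ι) :
    (pointIsometry hs).toContinuousLinearMap.adjoint f i = f (s i) := by
  classical
  rw [← inner_single_one (s i) f, ← pointIsometry_single hs i]
  change _ = ⟪(pointIsometry hs).toContinuousLinearMap _, f⟫_ℂ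
  rw [← ContinuousLinearMap.adjoint_inner_right, EuclideanSpace.inner_single_left, map_one,
    one_mul]

theorem pointIsometry_apply (hs : Function.Injective s) (x : EuclideanSpace ℂ ι) (i : ι) :
    pointIsometry hs x (s i) = x i := by
  rw [← adjoint_pointIsometry_apply hs]
  have h := (ContinuousLinearMap.norm_map_iff_adjoint_comp_self
    (pointIsometry hs).toContinuousLinearMap).1 (pointIsometry hs).norm_map
  exact congr($h x i)

theorem norm_adjoint_pointIsometry_le (hs : Function.Injective s) :
    ‖(pointIsometry hs).toContinuousLinearMap.adjoint‖ ≤ 1 :=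
  (LinearIsometryEquiv.norm_map _ _).trans_le (pointIsometry hs).norm_toContinuousLinearMap_le

end PointIsometry

section SchurBounded

open scoped Matrix Matrix.Norms.L2Operator

variable {ι κ : Type*} [Fintype ι] [Fintype κ] [DecidableEq κ]

/-- The matrix `M` is a Schur multiplier with constant `c`: Hadamard multiplication by `M` has norm
at most `c` on matrices with the operator norm of Euclidean spaces. -/
def IsSchurBounded (c : ℝ) (M : Matrix ι κ ℂ) : Prop :=
  ∀ A : Matrix ι κ ℂ, ‖M ⊙ A‖ ≤ c * ‖A‖

variable {S : Type u} {T : Type v} {Φ : S × T → ℂ} {s : ι → S} {t : κ → T}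

omit [Fintype ι] in
theorem toEuclideanLin_single_apply (M : Matrix ι κ ℂ) (i : ι) (j : κ) :
    Matrix.toEuclideanLin M (EuclideanSpace.single j 1) i = M i j := by
  rw [Matrix.ofLp_toLpLin, Matrix.toLin'_apply, PiLp.ofLp_single, Matrix.mulVec_single_one,
    Matrix.col_apply]

theorem exists_norm_le_matrixEntry_eq (hs : Function.Injective s) (ht : Function.Injective t)
    (A : Matrix ι κ ℂ) : ∃ A' : EllTwo T →L[ℂ] EllTwo S,
      ‖A'‖ ≤ ‖A‖ ∧ ∀ i j, matrixEntry A' (s i) (t j) = A i j := by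
  classical
  refine ⟨(pointIsometry hs).toContinuousLinearMap ∘L
    (Matrix.toEuclideanLin A).toContinuousLinearMap ∘L
      (pointIsometry ht).toContinuousLinearMap.adjoint, ?_, fun i j => ?_⟩
  · calc _ ≤ 1 * (‖A‖ * 1) := by
          grw [ContinuousLinearMap.opNorm_comp_le, ContinuousLinearMap.opNorm_comp_le,
            norm_adjoint_pointIsometry_le, LinearIsometry.norm_toContinuousLinearMap_le]
          rfl
      _ = ‖A‖ := by ring
  · have hsingle : (pointIsometry ht).toContinuousLinearMap.adjoint
        (lp.single (E := fun _ : T => ℂ) 2 (t j) (1 : ℂ)) = EuclideanSpace.single j 1 := by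
      ext k
      rw [adjoint_pointIsometry_apply, lp.single_apply, Pi.single_apply, PiLp.single_apply]
      simp only [ht.eq_iff]
    rw [← toEuclideanLin_single_apply A, ← pointIsometry_apply hs, ← hsingle, matrixEntry_def]
    rfl

theorem norm_le_of_forall_matrixEntry_eq (hs : Function.Injective s) (ht : Function.Injective t)
    {M : Matrix ι κ ℂ} {B : EllTwo T →L[ℂ] EllTwo S}
    (h : ∀ i j, matrixEntry B (s i) (t j) = M i j) : ‖M‖ ≤ ‖B‖ := by
  classical
  have hM : (Matrix.toEuclideanLin M).toContinuousLinearMap =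
      (pointIsometry hs).toContinuousLinearMap.adjoint ∘L B ∘L
        (pointIsometry ht).toContinuousLinearMap := by
    refine ContinuousLinearMap.coe_injective
      ((EuclideanSpace.basisFun κ ℂ).toBasis.ext fun j => ?_)
    ext i
    rw [OrthonormalBasis.coe_toBasis, EuclideanSpace.basisFun_apply]
    calc Matrix.toEuclideanLin M (EuclideanSpace.single j 1) i
        = B (pointIsometry ht (EuclideanSpace.single j 1)) (s i) := by
          rw [toEuclideanLin_single_apply, ← h, matrixEntry_def, pointIsometry_single]
      _ = _ := (adjoint_pointIsometry_apply hs _ i).symm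
  calc ‖M‖ = ‖(Matrix.toEuclideanLin M).toContinuousLinearMap‖ := rfl
    _ ≤ 1 * (‖B‖ * 1) := by
      grw [hM, ContinuousLinearMap.opNorm_comp_le, ContinuousLinearMap.opNorm_comp_le,
        norm_adjoint_pointIsometry_le, LinearIsometry.norm_toContinuousLinearMap_le]
    _ = ‖B‖ := by ring

theorem isSchurBounded_of_injective (hΦ : IsDiscreteSchurMultiplier Φ)
    (hs : Function.Injective s) (ht : Function.Injective t) :
    IsSchurBounded (discreteSchurNorm Φ) (Matrix.of fun i j => Φ (s i, t j)) := by
  intro A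
  obtain ⟨A', hA', hentry⟩ := exists_norm_le_matrixEntry_eq hs ht A
  have hB := isSchurProduct_schurTransformer hΦ A'
  calc ‖Matrix.of (fun i j => Φ (s i, t j)) ⊙ A‖ ≤ ‖schurTransformer hΦ A'‖ :=
        norm_le_of_forall_matrixEntry_eq hs ht fun i j => by rw [hB, hentry]; rfl
    _ ≤ discreteSchurNorm Φ * ‖A'‖ := hB.norm_le hΦ
    _ ≤ discreteSchurNorm Φ * ‖A‖ := by gcongr; exact discreteSchurNorm_nonneg Φ

end SchurBounded

/-! ### Gram factorization of Schur bounded matrices -/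

section GramCone

theorem exists_euclideanSpace_inner_eq {n : Type*} [Fintype n] {H : Type*}
    [SeminormedAddCommGroup H] [InnerProductSpace ℂ H] (v : n → H) :
    ∃ u : n → EuclideanSpace ℂ n, ∀ k l, ⟪u k, u l⟫_ℂ = ⟪v k, v l⟫_ℂ := by
  classical
  open scoped MatrixOrder Matrix.Norms.L2Operator ComplexOrder in
  obtain ⟨B, hB⟩ := CStarAlgebra.nonneg_iff_eq_star_mul_self.1
    (Matrix.nonneg_iff_posSemidef.2 (Matrix.posSemidef_gram ℂ v))
  refine ⟨fun k => WithLp.toLp 2 fun m => B m k, fun k l => ?_⟩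
  rw [← Matrix.gram_apply v, hB, Matrix.mul_apply, PiLp.inner_apply]
  exact Finset.sum_congr rfl fun m _ => mul_comm _ _

variable {ι κ : Type*} [Fintype ι] [Fintype κ]

theorem isClosed_setOf_exists_gram : IsClosed {x : (ι ⊕ κ → ℝ) × (ι → κ → ℂ) |
    ∃ v : ι ⊕ κ → EuclideanSpace ℂ (ι ⊕ κ),
      (∀ k, ‖v k‖ ^ 2 ≤ x.1 k) ∧ ∀ i j, ⟪v (.inl i), v (.inr j)⟫_ℂ = x.2 i j} := by
  refine IsSeqClosed.isClosed fun x x₀ hx hlim => ?_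
  choose v hvx hvN using hx
  have hdiag : ∀ k, Filter.Tendsto (fun n => (x n).1 k) Filter.atTop (nhds (x₀.1 k)) := fun k =>
    ((continuous_apply k).tendsto _).comp ((continuous_fst.tendsto _).comp hlim)
  have hblock : ∀ i j, Filter.Tendsto (fun n => (x n).2 i j) Filter.atTop (nhds (x₀.2 i j)) :=
    fun i j => ((continuous_apply_apply i j).tendsto _).comp ((continuous_snd.tendsto _).comp hlim)
  choose r hr using fun k => (hdiag k).bddAbove_range
  have hbounded : ∀ n, v n ∈ Set.univ.pi fun k => Metric.closedBall 0 √(r k) := fun n k _ =>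
    mem_closedBall_zero_iff.2 (Real.le_sqrt_of_sq_le ((hvx n k).trans (hr k ⟨n, rfl⟩)))
  obtain ⟨w, -, φ, hφ, hw⟩ := (isCompact_univ_pi fun k =>
    isCompact_closedBall (0 : EuclideanSpace ℂ (ι ⊕ κ)) √(r k)).tendsto_subseq hbounded
  have hw' : ∀ k, Filter.Tendsto (fun n => v (φ n) k) Filter.atTop (nhds (w k)) :=
    tendsto_pi_nhds.1 hw
  refine ⟨w, fun k => ?_, fun i j => ?_⟩
  · exact le_of_tendsto_of_tendsto' ((hw' k).norm.pow 2) ((hdiag k).comp hφ.tendsto_atTop)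
      fun n => hvx (φ n) k
  · exact tendsto_nhds_unique ((hw' _).inner (hw' _))
      (((hblock i j).comp hφ.tendsto_atTop).congr fun n => (hvN (φ n) i j).symm)

/-- The closed convex cone of pairs `(d, N)` such that `N` is the off-diagonal block of a Gram
matrix whose diagonal is at most `d`. -/
def gramCone (ι κ : Type*) [Fintype ι] [Fintype κ] :
    ProperCone ℝ ((ι ⊕ κ → ℝ) × (ι → κ → ℂ)) where
  carrier := {x | ∃ v : ι ⊕ κ → EuclideanSpace ℂ (ι ⊕ κ),
    (∀ k, ‖v k‖ ^ 2 ≤ x.1 k) ∧ ∀ i j, ⟪v (.inl i), v (.inr j)⟫_ℂ = x.2 i j}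
  zero_mem' := ⟨0, by simp, by simp⟩
  add_mem' := by
    rintro x y ⟨v, hvx, hvN⟩ ⟨w, hwx, hwN⟩
    obtain ⟨u, hu⟩ := exists_euclideanSpace_inner_eq fun k => WithLp.toLp 2 (v k, w k)
    refine ⟨u, fun k => ?_, fun i j => ?_⟩
    · rw [← inner_self_eq_norm_sq (𝕜 := ℂ), hu, inner_self_eq_norm_sq, WithLp.prod_norm_sq_eq_of_L2]
      exact add_le_add (hvx k) (hwx k)
    · rw [hu, WithLp.prod_inner_apply]
      exact congrArg₂ _ (hvN i j) (hwN i j)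
  smul_mem' := by
    rintro ⟨r, hr⟩ x ⟨v, hvx, hvN⟩
    refine ⟨fun k => (√r : ℂ) • v k, fun k => ?_, fun i j => ?_⟩
    · rw [norm_smul, mul_pow, Complex.norm_real, Real.norm_of_nonneg r.sqrt_nonneg, Real.sq_sqrt hr]
      exact mul_le_mul_of_nonneg_left (hvx k) hr
    · rw [inner_smul_left, inner_smul_right, hvN, ← mul_assoc, Complex.conj_ofReal,
        ← Complex.ofReal_mul, Real.mul_self_sqrt hr]
      rfl
  isClosed' := isClosed_setOf_exists_gram

theorem mem_gramCone {H : Type*} [SeminormedAddCommGroup H] [InnerProductSpace ℂ H]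
    {x : (ι ⊕ κ → ℝ) × (ι → κ → ℂ)} (v : ι ⊕ κ → H) (hdiag : ∀ k, ‖v k‖ ^ 2 ≤ x.1 k)
    (hblock : ∀ i j, ⟪v (.inl i), v (.inr j)⟫_ℂ = x.2 i j) : x ∈ gramCone ι κ := by
  obtain ⟨u, hu⟩ := exists_euclideanSpace_inner_eq v
  refine ⟨u, fun k => ?_, fun i j => (hu _ _).trans (hblock i j)⟩
  rw [← inner_self_eq_norm_sq (𝕜 := ℂ), hu, inner_self_eq_norm_sq]
  exact hdiag k

end GramCone

section Haagerup

open scoped Matrix Matrix.Norms.L2Operator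

variable {ι κ : Type*} [Fintype ι] [Fintype κ]

theorem exists_eq_re_sum_mul (g : (ι → κ → ℂ) →ₗ[ℝ] ℝ) :
    ∃ b : ι → κ → ℂ, ∀ N, g N = (∑ i, ∑ j, b i j * N i j).re := by
  classical
  let e (i : ι) (j : κ) : ℂ →ₗ[ℝ] ι → κ → ℂ :=
    LinearMap.single ℝ (fun _ => κ → ℂ) i ∘ₗ LinearMap.single ℝ (fun _ => ℂ) j
  have hN : ∀ N : ι → κ → ℂ, N = ∑ i, ∑ j, e i j (N i j) := fun N => by
    ext i j
    simp [e, Finset.sum_apply, Pi.single_apply, ite_apply]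
  refine ⟨fun i j => g (e i j 1) - g (e i j Complex.I) * Complex.I, fun N => ?_⟩
  conv_lhs => rw [hN N]
  simp only [map_sum, Complex.re_sum]
  refine Finset.sum_congr rfl fun i _ => Finset.sum_congr rfl fun j _ => ?_
  have hz : N i j = (N i j).re • (1 : ℂ) + (N i j).im • Complex.I := by
    simp only [Complex.real_smul, mul_one, Complex.re_add_im]
  conv_lhs => rw [hz]
  simp only [map_add, map_smul, smul_eq_mul, Complex.mul_re, Complex.sub_re, Complex.sub_im,
    Complex.ofReal_re, Complex.mul_im, Complex.ofReal_im, Complex.I_re, Complex.I_im]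
  ring

variable [DecidableEq κ]

theorem inner_toEuclideanLin (A : Matrix ι κ ℂ) (y : EuclideanSpace ℂ ι)
    (x : EuclideanSpace ℂ κ) :
    ⟪y, Matrix.toEuclideanLin A x⟫_ℂ = ∑ i, ∑ j, A i j * (star (y i) * x j) := by
  simp only [PiLp.inner_apply, Matrix.ofLp_toLpLin, Matrix.toLin'_apply, Matrix.mulVec,
    dotProduct, RCLike.inner_apply, Finset.sum_mul]
  refine Finset.sum_congr rfl fun i _ => Finset.sum_congr rfl fun j _ => ?_
  rw [starRingEnd_apply]
  ring

theorem norm_inner_toEuclideanLin_le (A : Matrix ι κ ℂ) (y : EuclideanSpace ℂ ι)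
    (x : EuclideanSpace ℂ κ) : ‖⟪y, Matrix.toEuclideanLin A x⟫_ℂ‖ ≤ ‖y‖ * (‖A‖ * ‖x‖) :=
  (norm_inner_le_norm _ _).trans (mul_le_mul_of_nonneg_left
    ((Matrix.toEuclideanLin A).toContinuousLinearMap.le_opNorm x) (norm_nonneg y))

theorem l2_opNorm_le_two {A : Matrix ι κ ℂ}
    (h : ∀ (z : ι → ℂ) (w : κ → ℂ),
      (∑ i, ∑ j, A i j * (z i * w j)).re ≤ ∑ i, ‖z i‖ ^ 2 + ∑ j, ‖w j‖ ^ 2) : ‖A‖ ≤ 2 := by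
  refine ContinuousLinearMap.opNorm_le_of_re_inner_le zero_le_two fun x y hx hy => ?_
  rw [inner_re_symm]
  change RCLike.re ⟪y, Matrix.toEuclideanLin A x⟫_ℂ ≤ 2
  rw [inner_toEuclideanLin]
  refine (h (fun i => star (y i)) x).trans_eq ?_
  simp only [norm_star, ← EuclideanSpace.norm_sq_eq, hx, hy]
  norm_num

variable {c : ℝ} {M : Matrix ι κ ℂ} {a : ι ⊕ κ → ℝ} {b : ι → κ → ℂ}

/-- The weights `a` allow one to write `b i j = A i j * √(a i) * √(a j)` with `‖A‖ ≤ 2`. -/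
theorem IsSchurBounded.re_sum_mul_le_of_pos (hc : 0 ≤ c) (hM : IsSchurBounded c M)
    (ha : ∀ k, 0 < a k)
    (hb : ∀ (z : ι → ℂ) (w : κ → ℂ), (∑ i, ∑ j, b i j * (z i * w j)).re ≤
      ∑ i, a (.inl i) * ‖z i‖ ^ 2 + ∑ j, a (.inr j) * ‖w j‖ ^ 2) :
    (∑ i, ∑ j, b i j * M i j).re ≤ c * ∑ k, a k := by
  let A : Matrix ι κ ℂ := .of fun i j => b i j / (√(a (.inl i)) * √(a (.inr j)))
  have hne : ∀ k, (√(a k) : ℂ) ≠ 0 := fun k =>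
    Complex.ofReal_ne_zero.2 (Real.sqrt_pos.2 (ha k)).ne'
  have hnorm : ∀ k (z : ℂ), a k * ‖z / √(a k)‖ ^ 2 = ‖z‖ ^ 2 := fun k z => by
    rw [norm_div, div_pow, Complex.norm_real, Real.norm_of_nonneg (Real.sqrt_nonneg _),
      Real.sq_sqrt (ha k).le, mul_div_cancel₀ _ (ha k).ne']
  have hA : ‖A‖ ≤ 2 := l2_opNorm_le_two fun z w => by
    convert hb (fun i => z i / √(a (.inl i))) (fun j => w j / √(a (.inr j))) using 1
    · congr 1
      refine Finset.sum_congr rfl fun i _ => Finset.sum_congr rfl fun j _ => ?_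
      have := hne (.inl i)
      have := hne (.inr j)
      simp only [A, Matrix.of_apply]
      field_simp
    · simp only [hnorm]
  let y : EuclideanSpace ℂ ι := WithLp.toLp 2 fun i => (√(a (.inl i)) : ℂ)
  let x : EuclideanSpace ℂ κ := WithLp.toLp 2 fun j => (√(a (.inr j)) : ℂ)
  have hxy : ‖y‖ ^ 2 + ‖x‖ ^ 2 = ∑ k, a k := by
    simp only [EuclideanSpace.norm_sq_eq, y, x, Complex.norm_real, Real.norm_eq_abs, sq_abs,
      Real.sq_sqrt (ha _).le, Fintype.sum_sum_type]
  have hinner : ⟪y, Matrix.toEuclideanLin (M ⊙ A) x⟫_ℂ = ∑ i, ∑ j, b i j * M i j := by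
    rw [inner_toEuclideanLin]
    refine Finset.sum_congr rfl fun i _ => Finset.sum_congr rfl fun j _ => ?_
    have := hne (.inl i)
    have := hne (.inr j)
    simp only [A, y, x, Matrix.hadamard_apply, Matrix.of_apply, Complex.star_def,
      Complex.conj_ofReal]
    field_simp
  calc (∑ i, ∑ j, b i j * M i j).re ≤ ‖⟪y, Matrix.toEuclideanLin (M ⊙ A) x⟫_ℂ‖ :=
        hinner ▸ Complex.re_le_norm _
    _ ≤ ‖y‖ * (‖M ⊙ A‖ * ‖x‖) := norm_inner_toEuclideanLin_le _ _ _
    _ ≤ ‖y‖ * (c * 2 * ‖x‖) := by grw [hM A, hA]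
    _ = c * (2 * ‖y‖ * ‖x‖) := by ring
    _ ≤ c * ∑ k, a k := by grw [two_mul_le_add_sq, hxy]

theorem IsSchurBounded.re_sum_mul_le (hc : 0 ≤ c) (hM : IsSchurBounded c M)
    (ha : ∀ k, 0 ≤ a k)
    (hb : ∀ (z : ι → ℂ) (w : κ → ℂ), (∑ i, ∑ j, b i j * (z i * w j)).re ≤
      ∑ i, a (.inl i) * ‖z i‖ ^ 2 + ∑ j, a (.inr j) * ‖w j‖ ^ 2) :
    (∑ i, ∑ j, b i j * M i j).re ≤ c * ∑ k, a k := by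
  have hlim : Filter.Tendsto (fun δ : ℝ => c * ∑ k, (a k + δ)) (nhdsWithin 0 (Set.Ioi 0))
      (nhds (c * ∑ k, (a k + 0))) :=
    Continuous.tendsto (by fun_prop) 0 |>.mono_left nhdsWithin_le_nhds
  simp only [add_zero] at hlim
  refine ge_of_tendsto hlim (Filter.eventually_of_mem self_mem_nhdsWithin fun δ hδ => ?_)
  have hδ : 0 < δ := hδ
  refine hM.re_sum_mul_le_of_pos hc (fun k => add_pos_of_nonneg_of_pos (ha k) hδ) fun z w =>
    (hb z w).trans ?_
  gcongr <;> exact le_add_of_nonneg_right hδ.le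

theorem IsSchurBounded.mem_gramCone (hc : 0 ≤ c) (hM : IsSchurBounded c M) :
    ((fun _ => c, fun i j => M i j) : (ι ⊕ κ → ℝ) × (ι → κ → ℂ)) ∈ gramCone ι κ := by
  classical
  by_contra hmem
  obtain ⟨f, hf, hfM⟩ := (gramCone ι κ).hyperplane_separation_point hmem
  let a : ι ⊕ κ → ℝ := fun k => f (Pi.single k 1, 0)
  obtain ⟨b, hb⟩ := exists_eq_re_sum_mul
    (-((f : (ι ⊕ κ → ℝ) × (ι → κ → ℂ) →ₗ[ℝ] ℝ) ∘ₗ LinearMap.inr ℝ _ _))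
  have hf_apply : ∀ d N, f (d, N) = ∑ k, a k * d k - (∑ i, ∑ j, b i j * N i j).re := by
    intro d N
    have hd : f (d, 0) = ∑ k, a k * d k := by
      refine (LinearMap.pi_apply_eq_sum_univ
        ((f : (ι ⊕ κ → ℝ) × (ι → κ → ℂ) →ₗ[ℝ] ℝ) ∘ₗ LinearMap.inl ℝ _ _) d).trans
        (Finset.sum_congr rfl fun k _ => (mul_comm _ _).trans (congrArg (· * d k) ?_))
      refine congrArg (fun e : ι ⊕ κ → ℝ => f (e, 0)) (funext fun j => ?_)
      exact (if_congr eq_comm rfl rfl).trans (Pi.single_apply k 1 j).symm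
    rw [← hb, ← hd, LinearMap.neg_apply, sub_neg_eq_add]
    change f (d, N) = f (d, 0) + f (0, N)
    rw [← map_add, Prod.mk_add_mk, add_zero, zero_add]
  have ha : ∀ k, 0 ≤ a k := fun k => hf _ <| SchurMult.mem_gramCone (0 : ι ⊕ κ → ℂ)
    (fun l => by by_cases h : l = k <;> simp [h]) fun i j => by simp
  refine hfM.not_ge ?_
  rw [hf_apply, ← Finset.sum_mul, mul_comm, sub_nonneg]
  refine hM.re_sum_mul_le hc ha fun z w => ?_
  rw [← sub_nonneg]
  have h := hf _ <| SchurMult.mem_gramCone (H := ℂ) (Sum.elim (fun i => star (z i)) w)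
    (x := (Sum.elim (fun i => ‖z i‖ ^ 2) fun j => ‖w j‖ ^ 2, fun i j => z i * w j))
    (by rintro (i | j) <;> simp) (fun i j => by simp [mul_comm])
  simpa [hf_apply] using h

theorem IsSchurBounded.exists_gram_vectors (hc : 0 ≤ c) (hM : IsSchurBounded c M) :
    ∃ x : ι ⊕ κ → EuclideanSpace ℂ (ι ⊕ κ), (∀ k, ‖x k‖ ^ 2 ≤ c) ∧
      ∀ i j, ⟪x (.inl i), x (.inr j)⟫_ℂ = M i j :=
  hM.mem_gramCone hc

end Haagerup

/-! ### Averages of discrete Schur multipliers -/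

section SchurBoundedConvex

open scoped Matrix Matrix.Norms.L2Operator

variable {ι κ : Type*} [Fintype ι] [Fintype κ] [DecidableEq κ]

theorem isClosed_setOf_isSchurBounded (c : ℝ) :
    IsClosed {M : ι → κ → ℂ | IsSchurBounded c (Matrix.of M)} := by
  simp only [IsSchurBounded, Set.ofPred_forall]
  refine isClosed_iInter fun A => isClosed_le (Continuous.norm ?_) continuous_const
  exact continuous_pi fun i => continuous_pi fun j =>
    (continuous_apply_apply i j).mul continuous_const

theorem convex_setOf_isSchurBounded (c : ℝ) :
    Convex ℝ {M : ι → κ → ℂ | IsSchurBounded c (Matrix.of M)} := by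
  intro M hM N hN a b ha hb hab A
  have hsplit : Matrix.of (a • M + b • N) ⊙ A =
      (a : ℂ) • (Matrix.of M ⊙ A) + (b : ℂ) • (Matrix.of N ⊙ A) := by
    ext i j
    simp only [Matrix.hadamard_apply, Matrix.of_apply, Pi.add_apply, Pi.smul_apply,
      Matrix.add_apply, Matrix.smul_apply, Complex.real_smul, smul_eq_mul]
    ring
  calc ‖Matrix.of (a • M + b • N) ⊙ A‖ ≤ a * (c * ‖A‖) + b * (c * ‖A‖) := by
        grw [hsplit, norm_add_le, norm_smul, norm_smul, hM A, hN A, Complex.norm_of_nonneg ha,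
          Complex.norm_of_nonneg hb]
    _ = c * ‖A‖ := by rw [← add_mul, hab, one_mul]

end SchurBoundedConvex

section Average

variable {S : Type u} {T : Type v} {Φ : S × T → ℂ}

theorem norm_le_discreteSchurNorm (hΦ : IsDiscreteSchurMultiplier Φ) (x : S × T) :
    ‖Φ x‖ ≤ discreteSchurNorm Φ := by
  obtain ⟨v, hv, hinner⟩ := (isSchurBounded_of_injective hΦ
    (Function.injective_of_subsingleton fun _ : Unit => x.1)
    (Function.injective_of_subsingleton fun _ : Unit => x.2)).exists_gram_vectors
    (discreteSchurNorm_nonneg Φ)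
  calc ‖Φ x‖ = ‖⟪v (.inl ()), v (.inr ())⟫_ℂ‖ := by rw [hinner, Matrix.of_apply]
    _ ≤ ‖v (.inl ())‖ * ‖v (.inr ())‖ := norm_inner_le_norm _ _
    _ ≤ √(discreteSchurNorm Φ) * √(discreteSchurNorm Φ) := by
      gcongr <;> exact Real.le_sqrt_of_sq_le (hv _)
    _ = discreteSchurNorm Φ := Real.mul_self_sqrt (discreteSchurNorm_nonneg Φ)

theorem ae_injective_pi {ι : Type*} [Fintype ι] [MeasurableSpace S] {P : ι → Measure S}
    [∀ i, SigmaFinite (P i)] {A : ι → Set S} (hA : Pairwise (Function.onFun Disjoint A))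
    (hPA : ∀ i, ∀ᵐ s ∂P i, s ∈ A i) : ∀ᵐ s ∂Measure.pi P, Function.Injective s := by
  filter_upwards [ae_all_iff.2 fun i => (Measure.quasiMeasurePreserving_eval P i).ae (hPA i)]
    with s hs i k hik
  by_contra hne
  exact Set.disjoint_left.1 (hA hne) (hs i) (show s i ∈ A k from hik ▸ hs k)

variable [MeasurableSpace S] [MeasurableSpace T] {ι κ : Type*} [Fintype ι] [Fintype κ]
  [DecidableEq κ]

/-- The matrix is the mean of random submatrices of `Φ`, with independent rows and columns that are
distributed according to `P i` and `Q j`. -/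
theorem isSchurBounded_integral (hΦ : IsDiscreteSchurMultiplier Φ)
    (P : ι → Measure S) (Q : κ → Measure T) [∀ i, IsProbabilityMeasure (P i)]
    [∀ j, IsProbabilityMeasure (Q j)] (hmeas : ∀ i j, AEMeasurable Φ ((P i).prod (Q j)))
    {A : ι → Set S} {B : κ → Set T} (hA : Pairwise (Function.onFun Disjoint A))
    (hB : Pairwise (Function.onFun Disjoint B)) (hPA : ∀ i, ∀ᵐ s ∂P i, s ∈ A i)
    (hQB : ∀ j, ∀ᵐ t ∂Q j, t ∈ B j) :
    IsSchurBounded (discreteSchurNorm Φ) (Matrix.of fun i j => ∫ x, Φ x ∂(P i).prod (Q j)) := by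
  let ρ := (Measure.pi P).prod (Measure.pi Q)
  have hmp : ∀ i j, MeasurePreserving (fun x : (ι → S) × (κ → T) => (x.1 i, x.2 j)) ρ
      ((P i).prod (Q j)) := fun i j =>
    (measurePreserving_eval P i).prod (measurePreserving_eval Q j)
  have hint : ∀ i j, Integrable (fun x : (ι → S) × (κ → T) => Φ (x.1 i, x.2 j)) ρ := fun i j =>
    .of_bound ((hmeas i j).comp_quasiMeasurePreserving
      (hmp i j).quasiMeasurePreserving).aestronglyMeasurable (discreteSchurNorm Φ)
      (.of_forall fun _ => norm_le_discreteSchurNorm hΦ _)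
  have hmean : (∫ x, (fun i j => Φ (x.1 i, x.2 j)) ∂ρ) =
      fun i j => ∫ x, Φ x ∂(P i).prod (Q j) := by
    ext i j
    rw [eval_integral fun i => .of_eval (hint i), eval_integral (hint i),
      ← (hmp i j).map_eq, integral_map (hmp i j).aemeasurable]
    rw [(hmp i j).map_eq]
    exact (hmeas i j).aestronglyMeasurable
  have hmem := (convex_setOf_isSchurBounded (discreteSchurNorm Φ)).integral_mem (μ := ρ)
    (isClosed_setOf_isSchurBounded (ι := ι) (κ := κ) _) (f := fun x i j => Φ (x.1 i, x.2 j)) ?_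
    (.of_eval fun i => .of_eval (hint i))
  · exact hmean ▸ hmem
  filter_upwards [Measure.quasiMeasurePreserving_fst.ae (ae_injective_pi hA hPA),
    Measure.quasiMeasurePreserving_snd.ae (ae_injective_pi hB hQB)] with x hs ht
  exact isSchurBounded_of_injective hΦ hs ht

theorem isSchurBounded_setAverage (hΦ : IsDiscreteSchurMultiplier Φ)
    (μ : Measure S) (ν : Measure T) [IsFiniteMeasure μ] [IsFiniteMeasure ν]
    (hmeas : AEMeasurable Φ (μ.prod ν))
    {A : ι → Set S} {B : κ → Set T} (hA : Pairwise (Function.onFun Disjoint A))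
    (hB : Pairwise (Function.onFun Disjoint B)) (hAm : ∀ i, MeasurableSet (A i))
    (hBm : ∀ j, MeasurableSet (B j)) (hA0 : ∀ i, μ (A i) ≠ 0) (hB0 : ∀ j, ν (B j) ≠ 0) :
    IsSchurBounded (discreteSchurNorm Φ)
      (Matrix.of fun i j => ⨍ x in A i ×ˢ B j, Φ x ∂μ.prod ν) := by
  have := fun i => ProbabilityTheory.cond_isProbabilityMeasure (hA0 i)
  have := fun j => ProbabilityTheory.cond_isProbabilityMeasure (hB0 j)
  have hprod : ∀ i j, (ProbabilityTheory.cond μ (A i)).prod (ProbabilityTheory.cond ν (B j)) =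
      ProbabilityTheory.cond (μ.prod ν) (A i ×ˢ B j) := fun i j => by
    simp only [ProbabilityTheory.cond]
    rw [Measure.prod_smul_left, Measure.prod_smul_right, Measure.prod_restrict, smul_smul,
      Measure.prod_prod, ENNReal.mul_inv (.inl (hA0 i)) (.inl (measure_ne_top _ _))]
  have h := isSchurBounded_integral hΦ (fun i => ProbabilityTheory.cond μ (A i))
    (fun j => ProbabilityTheory.cond ν (B j))
    (fun i j => hprod i j ▸ hmeas.mono_ac ProbabilityTheory.cond_absolutelyContinuous) hA hB
    (fun i => ProbabilityTheory.ae_cond_mem (hAm i))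
    (fun j => ProbabilityTheory.ae_cond_mem (hBm j))
  simp only [hprod] at h
  simpa only [average, Measure.restrict_apply_univ, ProbabilityTheory.cond] using h

end Average

/-! ### Factorization of the averages over a finite partition -/

section FiniteStage

theorem pairwise_disjoint_preimage_singleton {X γ : Type*} (p : X → γ) (C : Set γ) :
    Pairwise (Function.onFun Disjoint fun c : C => p ⁻¹' {(c : γ)}) := fun _ _ hcd =>
  (Set.disjoint_singleton.2 (Subtype.coe_injective.ne hcd)).preimage p

theorem setIntegral_preimage_eq_of_fiber_eq {X γ E : Type*} [MeasurableSpace X] {m : Measure X}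
    [Finite γ] [MeasurableSpace γ] [MeasurableSingletonClass γ] [NormedAddCommGroup E]
    [NormedSpace ℝ E] {p : X → γ} (hp : Measurable p) {f g : X → E} (hf : Integrable f m)
    (hg : Integrable g m) (h : ∀ c, ∫ x in p ⁻¹' {c}, f x ∂m = ∫ x in p ⁻¹' {c}, g x ∂m)
    (C : Set γ) : ∫ x in p ⁻¹' C, f x ∂m = ∫ x in p ⁻¹' C, g x ∂m := by
  have := Fintype.ofFinite C
  have hC : p ⁻¹' C = ⋃ c : C, p ⁻¹' {(c : γ)} := by
    rw [← Set.preimage_iUnion, Set.iUnion_coe_set, Set.biUnion_of_singleton]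
  have hdisj := pairwise_disjoint_preimage_singleton p C
  have hmeas : ∀ c : C, MeasurableSet (p ⁻¹' {(c : γ)}) := fun c => hp (measurableSet_singleton _)
  rw [hC, integral_iUnion_fintype hmeas hdisj fun _ => hf.integrableOn,
    integral_iUnion_fintype hmeas hdisj fun _ => hg.integrableOn]
  exact Finset.sum_congr rfl fun c _ => h c

variable {S : Type u} {T : Type v} [MeasurableSpace S] [MeasurableSpace T] {μ : Measure S}
  {ν : Measure T} {H : Type*} [NormedAddCommGroup H] [InnerProductSpace ℂ H]

section Inner

variable {F : S → H} {G : T → H}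

theorem integrable_inner_prod [SFinite ν] (hF : Integrable F μ) (hG : Integrable G ν) :
    Integrable (fun x : S × T => ⟪F x.1, G x.2⟫_ℂ) (μ.prod ν) :=
  hF.op_fst_snd (op := fun x y => ⟪x, y⟫_ℂ) continuous_inner
    ⟨1, fun x y => (norm_inner_le_norm x y).trans_eq (by rw [one_mul])⟩ hG

theorem inner_integral_integral [CompleteSpace H] [SFinite μ] [SFinite ν] (hF : Integrable F μ)
    (hG : Integrable G ν) :
    ⟪∫ s, F s ∂μ, ∫ t, G t ∂ν⟫_ℂ = ∫ x : S × T, ⟪F x.1, G x.2⟫_ℂ ∂μ.prod ν := by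
  have hright : ∀ s, ∫ t, ⟪F s, G t⟫_ℂ ∂ν = star ⟪∫ t, G t ∂ν, F s⟫_ℂ := fun s => by
    rw [integral_inner hG]
    exact (inner_conj_symm _ _).symm
  rw [integral_prod _ (integrable_inner_prod hF hG)]
  simp only [hright]
  refine Eq.trans ?_ integral_conj.symm
  rw [integral_inner hF]
  exact (inner_conj_symm _ _).symm

end Inner

variable {Φ : S × T → ℂ} [IsFiniteMeasure μ] [IsFiniteMeasure ν]

theorem integrable_of_isDiscreteSchurMultiplier (hΦ : IsDiscreteSchurMultiplier Φ)
    (hmeas : AEMeasurable Φ (μ.prod ν)) : Integrable Φ (μ.prod ν) :=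
  .of_bound hmeas.aestronglyMeasurable _ (.of_forall (norm_le_discreteSchurNorm hΦ))

variable {α β : Type*} [MeasurableSpace α] [MeasurableSpace β] [MeasurableSingletonClass α]
  [MeasurableSingletonClass β] {π : S → α} {ϖ : T → β}

theorem exists_vectors_setIntegral_fiber_eq [Fintype α] [Fintype β]
    (hΦ : IsDiscreteSchurMultiplier Φ) (hmeas : AEMeasurable Φ (μ.prod ν)) (hπ : Measurable π)
    (hϖ : Measurable ϖ) :
    ∃ x : α ⊕ β → EuclideanSpace ℂ (α ⊕ β), (∀ k, ‖x k‖ ^ 2 ≤ discreteSchurNorm Φ) ∧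
      ∀ a b, ∫ z in (π ⁻¹' {a}) ×ˢ (ϖ ⁻¹' {b}), Φ z ∂μ.prod ν =
        μ.real (π ⁻¹' {a}) * ν.real (ϖ ⁻¹' {b}) * ⟪x (.inl a), x (.inr b)⟫_ℂ := by
  classical
  let α' : Set α := {a | μ (π ⁻¹' {a}) ≠ 0}
  let β' : Set β := {b | ν (ϖ ⁻¹' {b}) ≠ 0}
  obtain ⟨v, hv, hinner⟩ := (isSchurBounded_setAverage hΦ μ ν hmeas
    (pairwise_disjoint_preimage_singleton π α') (pairwise_disjoint_preimage_singleton ϖ β')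
    (fun a => hπ (measurableSet_singleton _))
    (fun b => hϖ (measurableSet_singleton _)) (fun a => a.2)
    fun b => b.2).exists_gram_vectors (discreteSchurNorm_nonneg Φ)
  let w : α ⊕ β → EuclideanSpace ℂ (α' ⊕ β') := Sum.elim
    (fun a => if ha : μ (π ⁻¹' {a}) ≠ 0 then v (.inl ⟨a, ha⟩) else 0)
    (fun b => if hb : ν (ϖ ⁻¹' {b}) ≠ 0 then v (.inr ⟨b, hb⟩) else 0)
  have hw : ∀ k, ‖w k‖ ^ 2 ≤ discreteSchurNorm Φ := by
    rintro (a | b) <;> simp only [w, Sum.elim_inl, Sum.elim_inr] <;> split_ifs <;>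
      simp [hv, discreteSchurNorm_nonneg]
  obtain ⟨x, hx⟩ := exists_euclideanSpace_inner_eq w
  refine ⟨x, fun k => ?_, fun a b => ?_⟩
  · rw [← inner_self_eq_norm_sq (𝕜 := ℂ), hx, inner_self_eq_norm_sq]
    exact hw k
  rw [hx]
  by_cases h : μ (π ⁻¹' {a}) ≠ 0 ∧ ν (ϖ ⁻¹' {b}) ≠ 0
  · simp only [w, Sum.elim_inl, Sum.elim_inr, dif_pos h.1, dif_pos h.2]
    rw [hinner, Matrix.of_apply, ← measure_smul_setAverage _ (measure_ne_top _ _),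
      measureReal_prod_prod, Complex.real_smul, Complex.ofReal_mul]
  · have hzero : (μ.prod ν) ((π ⁻¹' {a}) ×ˢ (ϖ ⁻¹' {b})) = 0 := by
      rw [Measure.prod_prod, mul_eq_zero]
      tauto
    rw [setIntegral_measure_zero _ hzero, ← Complex.ofReal_mul, ← measureReal_prod_prod,
      Measure.real, hzero]
    simp

/-- The maps `F` and `G` are constant on the cells of the two partitions, and on a pair of cells
`⟪F s, G t⟫` is the average of `Φ`. -/
theorem exists_inner_setIntegral_eq [Fintype α] [Fintype β]
    (hΦ : IsDiscreteSchurMultiplier Φ) (hmeas : AEMeasurable Φ (μ.prod ν)) (hπ : Measurable π)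
    (hϖ : Measurable ϖ) :
    ∃ (F : S → EuclideanSpace ℂ (α ⊕ β)) (G : T → EuclideanSpace ℂ (α ⊕ β)),
      StronglyMeasurable F ∧ StronglyMeasurable G ∧
      (∀ s, ‖F s‖ ≤ √(discreteSchurNorm Φ)) ∧ (∀ t, ‖G t‖ ≤ √(discreteSchurNorm Φ)) ∧
      ∀ (A : Set α) (B : Set β), ⟪∫ s in π ⁻¹' A, F s ∂μ, ∫ t in ϖ ⁻¹' B, G t ∂ν⟫_ℂ =
        ∫ z in (π ⁻¹' A) ×ˢ (ϖ ⁻¹' B), Φ z ∂μ.prod ν := by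
  obtain ⟨x, hx, hinner⟩ := exists_vectors_setIntegral_fiber_eq hΦ hmeas hπ hϖ
  have hx' : ∀ k, ‖x k‖ ≤ √(discreteSchurNorm Φ) := fun k => Real.le_sqrt_of_sq_le (hx k)
  have hFm : StronglyMeasurable fun s => x (.inl (π s)) :=
    ((measurable_of_finite fun a => x (.inl a)).comp hπ).stronglyMeasurable
  have hGm : StronglyMeasurable fun t => x (.inr (ϖ t)) :=
    ((measurable_of_finite fun b => x (.inr b)).comp hϖ).stronglyMeasurable
  have hF : Integrable (fun s => x (.inl (π s))) μ :=
    .of_bound hFm.aestronglyMeasurable _ (.of_forall fun _ => hx' _)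
  have hG : Integrable (fun t => x (.inr (ϖ t))) ν :=
    .of_bound hGm.aestronglyMeasurable _ (.of_forall fun _ => hx' _)
  refine ⟨_, _, hFm, hGm, fun _ => hx' _, fun _ => hx' _, fun A B => ?_⟩
  rw [inner_integral_integral hF.integrableOn hG.integrableOn, Measure.prod_restrict]
  refine setIntegral_preimage_eq_of_fiber_eq (hπ.prodMap hϖ) (integrable_inner_prod hF hG)
    (integrable_of_isDiscreteSchurMultiplier hΦ hmeas) (fun ⟨a, b⟩ => ?_) (A ×ˢ B)
  have hcell : Prod.map π ϖ ⁻¹' {(a, b)} = (π ⁻¹' {a}) ×ˢ (ϖ ⁻¹' {b}) := by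
    rw [← Set.singleton_prod_singleton]
    rfl
  have hconst : Set.EqOn (fun z : S × T => ⟪x (.inl (π z.1)), x (.inr (ϖ z.2))⟫_ℂ)
      (fun _ => ⟪x (.inl a), x (.inr b)⟫_ℂ) ((π ⁻¹' {a}) ×ˢ (ϖ ⁻¹' {b})) := by
    rintro z ⟨rfl, rfl⟩
    rfl
  rw [hcell, hinner, setIntegral_congr_fun ((hπ (measurableSet_singleton a)).prod
    (hϖ (measurableSet_singleton b))) hconst, setIntegral_const, measureReal_prod_prod,
    Complex.real_smul, Complex.ofReal_mul]

end FiniteStage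

/-! ### Factorization through a Hilbert space -/

section Ultralimit

variable {E : Type*} [NormedAddCommGroup E] [InnerProductSpace ℂ E] [CompleteSpace E] {J : Type*}

theorem exists_tendsto_inner_ultrafilter (U : Ultrafilter J) (Q : J → E →L[ℂ] E) {C : ℝ}
    (hC : ∀ j, ‖Q j‖ ≤ C) :
    ∃ K : E →L[ℂ] E, ∀ f g, Filter.Tendsto (fun j => ⟪Q j f, g⟫_ℂ) U (nhds ⟪K f, g⟫_ℂ) := by
  have hlim : ∀ f g, ∃ x : ℂ, ‖x‖ ≤ C * ‖f‖ * ‖g‖ ∧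
      Filter.Tendsto (fun j => ⟪Q j f, g⟫_ℂ) U (nhds x) := fun f g => by
    have hmem : ∀ j, ⟪Q j f, g⟫_ℂ ∈ Metric.closedBall (0 : ℂ) (C * ‖f‖ * ‖g‖) := fun j =>
      mem_closedBall_zero_iff.2 <| (norm_inner_le_norm _ _).trans <| by
        grw [(Q j).le_of_opNorm_le (hC j) f]
    obtain ⟨x, hx, hx'⟩ := (isCompact_closedBall (0 : ℂ) (C * ‖f‖ * ‖g‖)).ultrafilter_le_nhds
      (U.map fun j => ⟪Q j f, g⟫_ℂ)
      (Filter.le_principal_iff.2 (Filter.mem_map.2 (Filter.univ_mem' hmem)))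
    exact ⟨x, mem_closedBall_zero_iff.1 hx, hx'⟩
  choose b hbn hbt using hlim
  let L : E →ₗ⋆[ℂ] E →ₗ[ℂ] ℂ := LinearMap.mk₂'ₛₗ (starRingEnd ℂ) (RingHom.id ℂ) b
    (fun f f' g => tendsto_nhds_unique (hbt (f + f') g)
      (((hbt f g).add (hbt f' g)).congr fun j => by rw [map_add, inner_add_left]))
    (fun c f g => tendsto_nhds_unique (hbt (c • f) g)
      (((hbt f g).const_mul _).congr fun j => by rw [map_smul, inner_smul_left]))
    (fun f g g' => tendsto_nhds_unique (hbt f (g + g'))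
      (((hbt f g).add (hbt f g')).congr fun j => by rw [inner_add_right]))
    (fun c f g => tendsto_nhds_unique (hbt f (c • g))
      (((hbt f g).const_mul _).congr fun j => by rw [inner_smul_right]; rfl))
  refine ⟨InnerProductSpace.continuousLinearMapOfBilin (L.mkContinuous₂ C hbn), fun f g => ?_⟩
  rw [InnerProductSpace.continuousLinearMapOfBilin_apply]
  exact hbt f g

omit [CompleteSpace E] in
theorem isPositive_of_tendsto_inner {l : Filter J} [l.NeBot] {Q : J → E →L[ℂ] E} {K : E →L[ℂ] E}
    (hQ : ∀ j, (Q j).IsPositive)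
    (h : ∀ f, Filter.Tendsto (fun j => ⟪Q j f, f⟫_ℂ) l (nhds ⟪K f, f⟫_ℂ)) : K.IsPositive := by
  rw [ContinuousLinearMap.isPositive_iff_complex]
  intro f
  have hre := (Complex.continuous_re.tendsto _).comp (h f)
  refine ⟨?_, ge_of_tendsto' hre fun j => (hQ j).re_inner_nonneg_left f⟩
  refine tendsto_nhds_unique ((Complex.continuous_ofReal.tendsto _).comp hre)
    ((h f).congr fun j => ?_)
  exact (((ContinuousLinearMap.isPositive_iff_complex _).1 (hQ j)) f).1.symm

theorem inner_sqrt_sqrt_of_isPositive {K : E →L[ℂ] E} (hK : K.IsPositive) (f g : E) :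
    ⟪CFC.sqrt K f, CFC.sqrt K g⟫_ℂ = ⟪K f, g⟫_ℂ := by
  have hnonneg : 0 ≤ K := (ContinuousLinearMap.nonneg_iff_isPositive K).2 hK
  have hsa : IsSelfAdjoint (CFC.sqrt K) := IsSelfAdjoint.of_nonneg (CFC.sqrt_nonneg K)
  rw [← ContinuousLinearMap.adjoint_inner_left, hsa.adjoint_eq,
    ← ContinuousLinearMap.comp_apply]
  exact congr(⟪$(CFC.sqrt_mul_sqrt_self K hnonneg) f, g⟫_ℂ)

variable {H : J → Type*} [∀ j, NormedAddCommGroup (H j)] [∀ j, InnerProductSpace ℂ (H j)]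

omit [CompleteSpace E] in
theorem tendsto_norm_of_tendsto_inner_self {l : Filter J} {x : ∀ j, H j} {y : E}
    (h : Filter.Tendsto (fun j => ⟪x j, x j⟫_ℂ) l (nhds ⟪y, y⟫_ℂ)) :
    Filter.Tendsto (fun j => ‖x j‖) l (nhds ‖y‖) := by
  simp only [norm_eq_sqrt_re_inner (𝕜 := ℂ)]
  exact ((Complex.continuous_re.tendsto _).comp h).sqrt

variable [∀ j, CompleteSpace (H j)]

theorem exists_tendsto_inner_apply_apply (U : Ultrafilter J) (V : ∀ j, E →L[ℂ] H j) {C : ℝ}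
    (hV : ∀ j, ‖V j‖ ≤ C) : ∃ W : E →L[ℂ] E, ∀ f g,
      Filter.Tendsto (fun j => ⟪V j f, V j g⟫_ℂ) U (nhds ⟪W f, W g⟫_ℂ) := by
  obtain ⟨K, hK⟩ := exists_tendsto_inner_ultrafilter U (fun j => (V j).adjoint ∘L V j)
    (C := C * C) fun j => by
      rw [ContinuousLinearMap.norm_adjoint_comp_self]
      exact mul_self_le_mul_self (norm_nonneg _) (hV j)
  have hpos : K.IsPositive := isPositive_of_tendsto_inner
    (fun j => ContinuousLinearMap.isPositive_adjoint_comp_self (V j)) fun f => hK f f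
  refine ⟨CFC.sqrt K, fun f g => ?_⟩
  rw [inner_sqrt_sqrt_of_isPositive hpos]
  exact (hK f g).congr fun j => ContinuousLinearMap.adjoint_inner_left _ _ _

variable {E₁ E₂ : Type*} [NormedAddCommGroup E₁] [InnerProductSpace ℂ E₁] [CompleteSpace E₁]
  [NormedAddCommGroup E₂] [InnerProductSpace ℂ E₂] [CompleteSpace E₂]

theorem exists_tendsto_inner_apply_apply_prod (U : Ultrafilter J) (X : ∀ j, E₁ →L[ℂ] H j)
    (Y : ∀ j, E₂ →L[ℂ] H j) {C D : ℝ} (hX : ∀ j, ‖X j‖ ≤ C) (hY : ∀ j, ‖Y j‖ ≤ D) :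
    ∃ (X' : E₁ →L[ℂ] WithLp 2 (E₁ × E₂)) (Y' : E₂ →L[ℂ] WithLp 2 (E₁ × E₂)),
      (∀ f, Filter.Tendsto (fun j => ‖X j f‖) U (nhds ‖X' f‖)) ∧
      (∀ g, Filter.Tendsto (fun j => ‖Y j g‖) U (nhds ‖Y' g‖)) ∧
      ∀ f g, Filter.Tendsto (fun j => ⟪X j f, Y j g⟫_ℂ) U (nhds ⟪X' f, Y' g⟫_ℂ) := by
  let i₁ : E₁ →L[ℂ] WithLp 2 (E₁ × E₂) :=
    (WithLp.prodContinuousLinearEquiv 2 ℂ E₁ E₂).symm ∘L .inl ℂ E₁ E₂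
  let i₂ : E₂ →L[ℂ] WithLp 2 (E₁ × E₂) :=
    (WithLp.prodContinuousLinearEquiv 2 ℂ E₁ E₂).symm ∘L .inr ℂ E₁ E₂
  let V : ∀ j, WithLp 2 (E₁ × E₂) →L[ℂ] H j := fun j =>
    X j ∘L WithLp.fstL 2 ℂ E₁ E₂ + Y j ∘L WithLp.sndL 2 ℂ E₁ E₂
  have hV : ∀ j, ‖V j‖ ≤ C * ‖WithLp.fstL 2 ℂ E₁ E₂‖ + D * ‖WithLp.sndL 2 ℂ E₁ E₂‖ := fun j => by
    refine (ContinuousLinearMap.opNorm_add_le _ _).trans (add_le_add ?_ ?_)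
    · grw [ContinuousLinearMap.opNorm_comp_le, hX j]
    · grw [ContinuousLinearMap.opNorm_comp_le, hY j]
  have hV₁ : ∀ j f, V j (i₁ f) = X j f := fun j f => by simp [V, i₁]
  have hV₂ : ∀ j g, V j (i₂ g) = Y j g := fun j g => by simp [V, i₂]
  obtain ⟨W, hW⟩ := exists_tendsto_inner_apply_apply U V hV
  refine ⟨W ∘L i₁, W ∘L i₂, fun f => tendsto_norm_of_tendsto_inner_self ?_,
    fun g => tendsto_norm_of_tendsto_inner_self ?_, fun f g => ?_⟩
  · exact (hW (i₁ f) (i₁ f)).congr fun j => by rw [hV₁]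
  · exact (hW (i₂ g) (i₂ g)).congr fun j => by rw [hV₂]
  · exact (hW (i₁ f) (i₂ g)).congr fun j => by rw [hV₁, hV₂]

end Ultralimit

section L2

variable {Z : Type*} [MeasurableSpace Z] {ρ : Measure Z} [IsFiniteMeasure ρ]

/-- The indicator function of a measurable set as an element of `L²`. -/
def indicatorL2 (ρ : Measure Z) [IsFiniteMeasure ρ] {E : Set Z} (hE : MeasurableSet E) :
    Lp ℂ 2 ρ :=
  indicatorConstLp 2 hE (measure_ne_top ρ E) 1

theorem inner_indicatorL2 {E : Set Z} (hE : MeasurableSet E) (f : Lp ℂ 2 ρ) :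
    ⟪indicatorL2 ρ hE, f⟫_ℂ = ∫ z in E, f z ∂ρ :=
  L2.inner_indicatorConstLp_one hE (measure_ne_top ρ E) f

theorem coeFn_indicatorL2 {E : Set Z} (hE : MeasurableSet E) :
    indicatorL2 ρ hE =ᵐ[ρ] E.indicator fun _ => (1 : ℂ) :=
  indicatorConstLp_coeFn

theorem integral_norm_indicatorL2 {E : Set Z} (hE : MeasurableSet E) :
    ∫ z, ‖indicatorL2 ρ hE z‖ ∂ρ = ρ.real E := by
  have h : (fun z => ‖indicatorL2 ρ hE z‖) =ᵐ[ρ] E.indicator fun _ => (1 : ℝ) := by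
    filter_upwards [coeFn_indicatorL2 (ρ := ρ) hE] with z hz
    rw [hz, norm_indicator_eq_indicator_norm, norm_one]
  rw [integral_congr_ae h, integral_indicator_const _ hE, smul_eq_mul, mul_one]

theorem integral_norm_le_sqrt_mul_norm (f : Lp ℂ 2 ρ) :
    ∫ z, ‖f z‖ ∂ρ ≤ √(ρ.real Set.univ) * ‖f‖ := by
  have h := eLpNorm_le_eLpNorm_mul_rpow_measure_univ (μ := ρ) (p := 1) (q := 2) (by norm_num)
    (Lp.memLp f).1
  have hexp : 1 / (1 : ℝ≥0∞).toReal - 1 / (2 : ℝ≥0∞).toReal = 1 / 2 := by norm_num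
  rw [hexp] at h
  have hfin : ρ Set.univ ^ (1 / 2 : ℝ) ≠ ∞ :=
    ENNReal.rpow_ne_top_of_nonneg (by norm_num) (measure_ne_top _ _)
  rw [integral_norm_eq_lintegral_enorm (Lp.memLp f).1, ← eLpNorm_one_eq_lintegral_enorm,
    Lp.norm_def, mul_comm, Real.sqrt_eq_rpow, Measure.real, ENNReal.toReal_rpow,
    ← ENNReal.toReal_mul]
  exact ENNReal.toReal_mono (ENNReal.mul_ne_top (Lp.memLp f).2.ne hfin) h

variable {H : Type*} [NormedAddCommGroup H] [InnerProductSpace ℂ H] [CompleteSpace H]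

/-- The operator `f ↦ ∫ f F` from `L²` into `H`, for a vector function `F` in `L²`. -/
def l2Integral (F : Lp H 2 ρ) : Lp ℂ 2 ρ →L[ℂ] H :=
  (ContinuousLinearMap.lpPairing ρ 2 2 (.lsmul ℂ ℂ)).flip F

omit [IsFiniteMeasure ρ] in
theorem l2Integral_apply (F : Lp H 2 ρ) (f : Lp ℂ 2 ρ) :
    l2Integral F f = ∫ z, f z • F z ∂ρ :=
  ContinuousLinearMap.lpPairing_eq_integral _ f F

theorem l2Integral_indicatorL2 (F : Lp H 2 ρ) {E : Set Z} (hE : MeasurableSet E) :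
    l2Integral F (indicatorL2 ρ hE) = ∫ z in E, F z ∂ρ := by
  rw [l2Integral_apply, ← integral_indicator hE]
  refine integral_congr_ae ?_
  filter_upwards [coeFn_indicatorL2 (ρ := ρ) hE] with z hz
  rw [hz, ← Set.indicator_smul_apply_left]
  simp only [one_smul]

theorem norm_l2Integral_apply_le {F : Lp H 2 ρ} {r : ℝ} (hF : ∀ᵐ z ∂ρ, ‖F z‖ ≤ r)
    (f : Lp ℂ 2 ρ) : ‖l2Integral F f‖ ≤ r * ∫ z, ‖f z‖ ∂ρ := by
  rw [l2Integral_apply, ← integral_const_mul]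
  have hf : Integrable f ρ := (Lp.memLp f).integrable one_le_two
  refine norm_integral_le_of_norm_le (hf.norm.const_mul r) ?_
  filter_upwards [hF] with z hz
  grw [norm_smul, hz, mul_comm]

theorem exists_clm_eq_setIntegral {F : Z → H} {r : ℝ} (hF : AEStronglyMeasurable F ρ)
    (hr : ∀ z, ‖F z‖ ≤ r) : ∃ X : Lp ℂ 2 ρ →L[ℂ] H,
      (∀ f, ‖X f‖ ≤ r * ∫ z, ‖f z‖ ∂ρ) ∧
      ∀ E (hE : MeasurableSet E), X (indicatorL2 ρ hE) = ∫ z in E, F z ∂ρ := by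
  have hmem : MemLp F 2 ρ := .of_bound hF r (.of_forall hr)
  refine ⟨l2Integral hmem.toLp, norm_l2Integral_apply_le ?_, fun E hE => ?_⟩
  · filter_upwards [hmem.coeFn_toLp] with z hz
    exact hz ▸ hr z
  · rw [l2Integral_indicatorL2]
    exact setIntegral_congr_ae hE (hmem.coeFn_toLp.mono fun z hz _ => hz)

end L2

section HilbertFactorization

variable {S : Type u} {T : Type v} [MeasurableSpace S] [MeasurableSpace T] {μ : Measure S}
  {ν : Measure T} [IsFiniteMeasure μ] [IsFiniteMeasure ν] {Φ : S × T → ℂ}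

theorem exists_clm_inner_eq_setIntegral_preimage {α β : Type*} [Fintype α] [Fintype β]
    [MeasurableSpace α] [MeasurableSpace β] [MeasurableSingletonClass α]
    [MeasurableSingletonClass β] {π : S → α} {ϖ : T → β} (hΦ : IsDiscreteSchurMultiplier Φ)
    (hmeas : AEMeasurable Φ (μ.prod ν)) (hπ : Measurable π) (hϖ : Measurable ϖ) :
    ∃ (X : Lp ℂ 2 μ →L[ℂ] EuclideanSpace ℂ (α ⊕ β)) (Y : Lp ℂ 2 ν →L[ℂ] EuclideanSpace ℂ (α ⊕ β)),
      (∀ f, ‖X f‖ ≤ √(discreteSchurNorm Φ) * ∫ s, ‖f s‖ ∂μ) ∧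
      (∀ g, ‖Y g‖ ≤ √(discreteSchurNorm Φ) * ∫ t, ‖g t‖ ∂ν) ∧
      ∀ (A : Set α) (B : Set β) (hA : MeasurableSet (π ⁻¹' A)) (hB : MeasurableSet (ϖ ⁻¹' B)),
        ⟪X (indicatorL2 μ hA), Y (indicatorL2 ν hB)⟫_ℂ =
          ∫ z in (π ⁻¹' A) ×ˢ (ϖ ⁻¹' B), Φ z ∂μ.prod ν := by
  obtain ⟨F, G, hFm, hGm, hF, hG, hinner⟩ := exists_inner_setIntegral_eq hΦ hmeas hπ hϖ
  obtain ⟨X, hX, hXE⟩ := exists_clm_eq_setIntegral (ρ := μ) hFm.aestronglyMeasurable hF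
  obtain ⟨Y, hY, hYE⟩ := exists_clm_eq_setIntegral (ρ := ν) hGm.aestronglyMeasurable hG
  exact ⟨X, Y, hX, hY, fun A B hA hB => by rw [hXE, hYE, hinner]⟩

theorem exists_measurable_finite_preimage {X : Type*} [MeasurableSpace X]
    (𝓕 : Finset {E : Set X // MeasurableSet E}) :
    ∃ p : X → (𝓕 → Prop), Measurable p ∧ ∀ E ∈ 𝓕, ∃ A, p ⁻¹' A = E :=
  ⟨fun x E => x ∈ E.1.1, measurable_pi_iff.2 fun E => E.1.2.mem,
    fun E hE => ⟨{q | q ⟨E, hE⟩}, rfl⟩⟩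

/-- The ultralimit along refining finite partitions of the finite-stage operators. -/
theorem exists_clm_inner_indicatorL2_eq_setIntegral (hΦ : IsDiscreteSchurMultiplier Φ)
    (hmeas : AEMeasurable Φ (μ.prod ν)) :
    ∃ (X : Lp ℂ 2 μ →L[ℂ] WithLp 2 (Lp ℂ 2 μ × Lp ℂ 2 ν))
      (Y : Lp ℂ 2 ν →L[ℂ] WithLp 2 (Lp ℂ 2 μ × Lp ℂ 2 ν)),
      (∀ E (hE : MeasurableSet E), ‖X (indicatorL2 μ hE)‖ ≤ √(discreteSchurNorm Φ) * μ.real E) ∧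
      (∀ G (hG : MeasurableSet G), ‖Y (indicatorL2 ν hG)‖ ≤ √(discreteSchurNorm Φ) * ν.real G) ∧
      ∀ E G (hE : MeasurableSet E) (hG : MeasurableSet G),
        ⟪X (indicatorL2 μ hE), Y (indicatorL2 ν hG)⟫_ℂ = ∫ z in E ×ˢ G, Φ z ∂μ.prod ν := by
  classical
  let J := Finset {E : Set S // MeasurableSet E} × Finset {G : Set T // MeasurableSet G}
  choose π hπ hπE using exists_measurable_finite_preimage (X := S)
  choose ϖ hϖ hϖG using exists_measurable_finite_preimage (X := T)
  choose X Y hX hY hXY using fun j : J =>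
    exists_clm_inner_eq_setIntegral_preimage (μ := μ) (ν := ν) hΦ hmeas (hπ j.1) (hϖ j.2)
  have hXnorm : ∀ j, ‖X j‖ ≤ √(discreteSchurNorm Φ) * √(μ.real Set.univ) := fun j =>
    (X j).opNorm_le_bound (by positivity) fun f => by
      grw [hX j f, integral_norm_le_sqrt_mul_norm, mul_assoc]
  have hYnorm : ∀ j, ‖Y j‖ ≤ √(discreteSchurNorm Φ) * √(ν.real Set.univ) := fun j =>
    (Y j).opNorm_le_bound (by positivity) fun g => by
      grw [hY j g, integral_norm_le_sqrt_mul_norm, mul_assoc]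
  obtain ⟨U, hU⟩ := Ultrafilter.exists_le (Filter.atTop : Filter J)
  obtain ⟨X', Y', hX', hY', hXY'⟩ :=
    exists_tendsto_inner_apply_apply_prod (U := U) X Y hXnorm hYnorm
  refine ⟨X', Y', fun E hE => ?_, fun G hG => ?_, fun E G hE hG => ?_⟩
  · exact le_of_tendsto' (hX' _) fun j => (hX j _).trans_eq (by rw [integral_norm_indicatorL2])
  · exact le_of_tendsto' (hY' _) fun j => (hY j _).trans_eq (by rw [integral_norm_indicatorL2])
  · have hlarge : ∀ᶠ j : J in Filter.atTop, ({⟨E, hE⟩}, {⟨G, hG⟩}) ≤ j :=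
      Filter.eventually_ge_atTop _
    refine tendsto_nhds_unique (hXY' _ _) (tendsto_const_nhds.congr' ?_)
    filter_upwards [hU hlarge] with j hj
    obtain ⟨A, rfl⟩ : ∃ A, π j.1 ⁻¹' A = E := hπE j.1 ⟨E, hE⟩ (Finset.singleton_subset_iff.1 hj.1)
    obtain ⟨B, rfl⟩ : ∃ B, ϖ j.2 ⁻¹' B = G := hϖG j.2 ⟨G, hG⟩ (Finset.singleton_subset_iff.1 hj.2)
    exact (hXY j A B hE hG).symm

end HilbertFactorization

/-! ### Integral operators are Hilbert–Schmidt -/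

section Kernel

variable {S : Type u} {T : Type v} [MeasurableSpace S] [MeasurableSpace T]
  {μ : Measure S} {ν : Measure T}

theorem memLp_mul_prod {f : S → ℂ} {g : T → ℂ} (hf : MemLp f 2 μ) (hg : MemLp g 2 ν) :
    MemLp (fun z : S × T => f z.1 * g z.2) 2 (μ.prod ν) := by
  refine (memLp_two_iff_integrable_sq_norm (hf.1.comp_fst.mul hg.1.comp_snd)).2 ?_
  simp only [Pi.mul_apply, norm_mul, mul_pow]
  exact ((memLp_two_iff_integrable_sq_norm hf.1).1 hf).mul_prod
    ((memLp_two_iff_integrable_sq_norm hg.1).1 hg)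

theorem integrable_star_mul_kernel_mul {h : S × T → ℂ} (hh : MemLp h 2 (μ.prod ν))
    (y : Lp ℂ 2 μ) (x : Lp ℂ 2 ν) :
    Integrable (fun z : S × T => star (y z.1) * (h z * x z.2)) (μ.prod ν) := by
  refine (hh.integrable_mul (memLp_mul_prod (Lp.memLp y).star (Lp.memLp x))).congr
    (.of_forall fun z => ?_)
  simp only [Pi.mul_apply, Pi.star_apply]
  ring

variable [SFinite μ] [SFinite ν]

theorem inner_integralOperator {h : S × T → ℂ} (hh : MemLp h 2 (μ.prod ν)) (y : Lp ℂ 2 μ)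
    (x : Lp ℂ 2 ν) : ⟪y, integralOperator μ ν h hh x⟫_ℂ =
      ∫ z, star (y z.1) * (h z * x z.2) ∂μ.prod ν := by
  rw [L2.inner_def, integral_prod _ (integrable_star_mul_kernel_mul hh y x)]
  refine integral_congr_ae ?_
  filter_upwards [integralOperator_apply μ ν h hh x] with s hs
  rw [hs, integral_const_mul, RCLike.inner_apply, mul_comm]
  rfl

omit [SFinite ν] in
theorem enorm_sq_eq_lintegral (f : Lp ℂ 2 ν) : ‖f‖ₑ ^ 2 = ∫⁻ t, ‖f t‖ₑ ^ 2 ∂ν := by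
  rw [Lp.enorm_def, eLpNorm_two_sq]

omit [SFinite ν] in
theorem tsum_enorm_integral_mul_sq {ι : Type*} (e : HilbertBasis ι ℂ (Lp ℂ 2 ν)) {g : T → ℂ}
    (hg : MemLp g 2 ν) :
    ∑' i, ‖∫ t, g t * e i t ∂ν‖ₑ ^ 2 = ∫⁻ t, ‖g t‖ₑ ^ 2 ∂ν := by
  have hinner : ∀ i, ∫ t, g t * e i t ∂ν = ⟪hg.star.toLp, e i⟫_ℂ := fun i => by
    rw [L2.inner_def]
    refine integral_congr_ae ?_
    filter_upwards [hg.star.coeFn_toLp] with t ht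
    rw [ht, RCLike.inner_apply, Pi.star_apply, ← starRingEnd_apply, Complex.conj_conj, mul_comm]
  calc ∑' i, ‖∫ t, g t * e i t ∂ν‖ₑ ^ 2 = ∑' i, ‖⟪e i, hg.star.toLp⟫_ℂ‖ₑ ^ 2 :=
        tsum_congr fun i => by rw [hinner, ← inner_conj_symm, RCLike.enorm_conj]
    _ = ‖hg.star.toLp‖ₑ ^ 2 := parseval_enorm e _
    _ = ∫⁻ t, ‖g t‖ₑ ^ 2 ∂ν := by
        rw [enorm_sq_eq_lintegral]
        refine lintegral_congr_ae ?_
        filter_upwards [hg.star.coeFn_toLp] with t ht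
        rw [ht, Pi.star_apply, ← starRingEnd_apply, RCLike.enorm_conj]

theorem tsum_enorm_integralOperator_sq_le {ι : Type*} (e : HilbertBasis ι ℂ (Lp ℂ 2 ν))
    {h : S × T → ℂ} (hh : MemLp h 2 (μ.prod ν)) :
    ∑' i, ‖integralOperator μ ν h hh (e i)‖ₑ ^ 2 ≤ eLpNorm h 2 (μ.prod ν) ^ 2 := by
  rw [ENNReal.tsum_eq_iSup_sum]
  refine iSup_le fun F => ?_
  have hmeas : ∀ i, AEMeasurable (fun s => ‖∫ t, h (s, t) * e i t ∂ν‖ₑ ^ 2) μ := fun i =>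
    (memLp_kernel hh (Lp.memLp (e i))).1.enorm.pow_const 2
  calc ∑ i ∈ F, ‖integralOperator μ ν h hh (e i)‖ₑ ^ 2
      = ∑ i ∈ F, ∫⁻ s, ‖∫ t, h (s, t) * e i t ∂ν‖ₑ ^ 2 ∂μ := by
        refine Finset.sum_congr rfl fun i _ => ?_
        rw [enorm_sq_eq_lintegral]
        refine lintegral_congr_ae ?_
        filter_upwards [integralOperator_apply μ ν h hh (e i)] with s hs
        rw [hs]
    _ = ∫⁻ s, ∑ i ∈ F, ‖∫ t, h (s, t) * e i t ∂ν‖ₑ ^ 2 ∂μ :=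
        (lintegral_finsetSum' F fun i _ => hmeas i).symm
    _ ≤ ∫⁻ s, ∫⁻ t, ‖h (s, t)‖ₑ ^ 2 ∂ν ∂μ := by
        refine lintegral_mono_ae ?_
        filter_upwards [ae_memLp_section hh] with s hs
        exact (ENNReal.sum_le_tsum F).trans_eq (tsum_enorm_integral_mul_sq e hs)
    _ = eLpNorm h 2 (μ.prod ν) ^ 2 := by
        rw [eLpNorm_two_sq, lintegral_prod _ (hh.1.enorm.pow_const 2)]

theorem countable_setOf_integralOperator_ne_zero {ι : Type*} (e : HilbertBasis ι ℂ (Lp ℂ 2 ν))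
    {h : S × T → ℂ} (hh : MemLp h 2 (μ.prod ν)) :
    {i | integralOperator μ ν h hh (e i) ≠ 0}.Countable := by
  have hfin : ∑' i, ‖integralOperator μ ν h hh (e i)‖ₑ ^ 2 ≠ ∞ :=
    ((tsum_enorm_integralOperator_sq_le e hh).trans_lt (ENNReal.pow_lt_top hh.2)).ne
  refine (Summable.countable_support_ennreal hfin).mono fun i hi => ?_
  simpa using hi

end Kernel

section IndicatorExt

variable {S : Type u} {T : Type v} [MeasurableSpace S] [MeasurableSpace T]
  {μ : Measure S} {ν : Measure T} [IsFiniteMeasure μ] [IsFiniteMeasure ν]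

theorem ext_inner_indicatorL2 {f g : Lp ℂ 2 μ}
    (h : ∀ E (hE : MeasurableSet E), ⟪indicatorL2 μ hE, f⟫_ℂ = ⟪indicatorL2 μ hE, g⟫_ℂ) :
    f = g := by
  refine Lp.ext (Integrable.ae_eq_of_forall_setIntegral_eq _ _
    ((Lp.memLp f).integrable one_le_two) ((Lp.memLp g).integrable one_le_two) fun E hE _ => ?_)
  simpa only [inner_indicatorL2] using h E hE

theorem clm_ext_inner_indicatorL2 {A B : Lp ℂ 2 ν →L[ℂ] Lp ℂ 2 μ}
    (h : ∀ E G (hE : MeasurableSet E) (hG : MeasurableSet G),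
      ⟪indicatorL2 μ hE, A (indicatorL2 ν hG)⟫_ℂ = ⟪indicatorL2 μ hE, B (indicatorL2 ν hG)⟫_ℂ) :
    A = B := by
  refine ContinuousLinearMap.adjoint.injective (ContinuousLinearMap.ext fun f =>
    ext_inner_indicatorL2 fun G hG => ?_)
  have hG' : A (indicatorL2 ν hG) = B (indicatorL2 ν hG) :=
    ext_inner_indicatorL2 fun E hE => h E G hE hG
  rw [ContinuousLinearMap.adjoint_inner_right, ContinuousLinearMap.adjoint_inner_right, hG']

theorem inner_indicatorL2_integralOperator_indicatorL2 {h : S × T → ℂ}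
    (hh : MemLp h 2 (μ.prod ν)) {E : Set S} {G : Set T} (hE : MeasurableSet E)
    (hG : MeasurableSet G) :
    ⟪indicatorL2 μ hE, integralOperator μ ν h hh (indicatorL2 ν hG)⟫_ℂ =
      ∫ z in E ×ˢ G, h z ∂μ.prod ν := by
  rw [inner_integralOperator, ← integral_indicator (hE.prod hG)]
  refine integral_congr_ae ?_
  filter_upwards [Measure.quasiMeasurePreserving_fst.ae (coeFn_indicatorL2 (ρ := μ) hE),
    Measure.quasiMeasurePreserving_snd.ae (coeFn_indicatorL2 (ρ := ν) hG)] with z h1 h2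
  rw [h1, h2]
  by_cases hz1 : z.1 ∈ E <;> by_cases hz2 : z.2 ∈ G <;> simp [Set.indicator, hz1, hz2]

end IndicatorExt

/-! ### Factorizations through separable spaces -/

section Parseval

variable {E : Type*} [NormedAddCommGroup E] [InnerProductSpace ℂ E]

theorem countable_of_orthonormal [TopologicalSpace.SeparableSpace E] {ι : Type*} {b : ι → E}
    (hb : Orthonormal ℂ b) : Countable ι := by
  refine Pairwise.countable_of_isOpen_disjoint (s := fun i => Metric.ball (b i) (1 / 2))
    (fun i j hij => Metric.ball_disjoint_ball ?_) (fun i => Metric.isOpen_ball)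
    fun i => ⟨b i, Metric.mem_ball_self (by norm_num)⟩
  have h : ‖b i - b j‖ ^ 2 = 2 := by
    rw [@norm_sub_sq ℂ, hb.2 hij, hb.1 i, hb.1 j]
    norm_num
  rw [dist_eq_norm]
  nlinarith [norm_nonneg (b i - b j)]

variable [CompleteSpace E]

theorem exists_parseval_sequence [TopologicalSpace.SeparableSpace E] :
    ∃ u : ℕ → E, ∀ x y, HasSum (fun n => ⟪x, u n⟫_ℂ * ⟪u n, y⟫_ℂ) ⟪x, y⟫_ℂ := by
  obtain ⟨w, b, -⟩ := exists_hilbertBasis ℂ E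
  have : Countable w := countable_of_orthonormal b.orthonormal
  obtain ⟨g, hg⟩ := exists_injective_nat w
  refine ⟨Function.extend g b 0, fun x y => (hg.hasSum_iff fun n hn => ?_).1 ?_⟩
  · rw [Function.extend_apply' _ _ _ (by simpa using hn), Pi.zero_apply, inner_zero_right,
      zero_mul]
  · simpa only [Function.comp_def, hg.extend_apply] using b.hasSum_inner_mul_inner x y

omit [CompleteSpace E] in
theorem sum_range_norm_inner_sq_le_of_hasSum {u : ℕ → E} {x : E} {r : ℝ}
    (h : HasSum (fun n => ⟪x, u n⟫_ℂ * ⟪u n, x⟫_ℂ) r) (N : ℕ) :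
    ∑ n ∈ Finset.range N, ‖⟪u n, x⟫_ℂ‖ ^ 2 ≤ r := by
  have hterm : ∀ n, (⟪x, u n⟫_ℂ * ⟪u n, x⟫_ℂ).re = ‖⟪u n, x⟫_ℂ‖ ^ 2 := fun n => by
    rw [← inner_conj_symm x (u n), RCLike.conj_mul]
    norm_cast
  have hre := Complex.hasSum_re h
  simp only [hterm, Complex.ofReal_re] at hre
  exact sum_le_hasSum _ (fun _ _ => by positivity) hre

theorem exists_parseval_sequence_of_isSeparable {s : Set E}
    (hs : TopologicalSpace.IsSeparable s) :
    ∃ u : ℕ → E, (∀ x N, ∑ n ∈ Finset.range N, ‖⟪u n, x⟫_ℂ‖ ^ 2 ≤ ‖x‖ ^ 2) ∧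
      ∀ x, ∀ y ∈ s, HasSum (fun n => ⟪x, u n⟫_ℂ * ⟪u n, y⟫_ℂ) ⟪x, y⟫_ℂ := by
  let V : Submodule ℂ E := (Submodule.span ℂ s).topologicalClosure
  have hsV : s ⊆ V := Submodule.subset_span.trans (Submodule.le_topologicalClosure _)
  have : CompleteSpace V := (Submodule.isClosed_topologicalClosure _).completeSpace_coe
  have : TopologicalSpace.SeparableSpace V :=
    TopologicalSpace.IsSeparable.separableSpace hs.span.closure
  obtain ⟨u, hu⟩ := exists_parseval_sequence (E := V)
  have hsum : ∀ x y : E, HasSum (fun n => ⟪x, (u n : E)⟫_ℂ * ⟪(u n : E), y⟫_ℂ)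
      ⟪V.orthogonalProjectionOnto x, V.orthogonalProjectionOnto y⟫_ℂ := fun x y => by
    simpa only [Submodule.inner_orthogonalProjectionOnto_eq_of_mem_right,
      Submodule.inner_orthogonalProjectionOnto_eq_of_mem_left] using
      hu (V.orthogonalProjectionOnto x) (V.orthogonalProjectionOnto y)
  refine ⟨fun n => u n, fun x N => ?_, fun x y hy => ?_⟩
  · have hx := hsum x x
    rw [inner_self_eq_norm_sq_to_K] at hx
    refine (sum_range_norm_inner_sq_le_of_hasSum (by exact_mod_cast hx) N).trans ?_
    exact pow_le_pow_left₀ (norm_nonneg _) (V.norm_orthogonalProjectionOnto_apply_le x) 2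
  · convert hsum x y
    rw [Submodule.inner_orthogonalProjectionOnto_eq_of_mem_right,
      Submodule.coe_orthogonalProjectionOnto_apply, Submodule.starProjection_eq_self_iff.2 (hsV hy)]

end Parseval

section SeparableFactorization

variable {E E₁ E₂ : Type*} [NormedAddCommGroup E] [InnerProductSpace ℂ E]
  [NormedAddCommGroup E₁] [InnerProductSpace ℂ E₁] [NormedAddCommGroup E₂] [InnerProductSpace ℂ E₂]
  {ι : Type*}

theorem isSeparable_range_of_countable_ne_zero {A : E₂ →L[ℂ] E} (e : HilbertBasis ι ℂ E₂)
    (he : {i | A (e i) ≠ 0}.Countable) : TopologicalSpace.IsSeparable (Set.range A) := by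
  set D : Set E := (fun i => A (e i)) '' {i | A (e i) ≠ 0}
  set V : Submodule ℂ E := (Submodule.span ℂ D).topologicalClosure
  have hV : TopologicalSpace.IsSeparable (V : Set E) := (he.image _).isSeparable.span.closure
  have hbasis : Set.range e ⊆ V.comap (A : E₂ →ₗ[ℂ] E) := by
    rintro _ ⟨i, rfl⟩
    by_cases hi : A (e i) = 0
    · exact (congrArg (· ∈ V) hi).mpr V.zero_mem
    · exact Submodule.le_topologicalClosure _ (Submodule.subset_span ⟨i, hi, rfl⟩)
  have htop : ⊤ ≤ V.comap (A : E₂ →ₗ[ℂ] E) := e.dense_span ▸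
    Submodule.topologicalClosure_minimal _ (Submodule.span_le.2 hbasis)
      ((Submodule.isClosed_topologicalClosure _).preimage A.continuous)
  exact hV.mono (Set.range_subset_iff.2 fun g => htop (Submodule.mem_top (x := g)))

theorem exists_hasSum_inner_mul_inner [CompleteSpace E] [CompleteSpace E₁] [CompleteSpace E₂]
    (X : E₁ →L[ℂ] E) (Y : E₂ →L[ℂ] E) (e : HilbertBasis ι ℂ E₂)
    (he : {i | ContinuousLinearMap.adjoint X (Y (e i)) ≠ 0}.Countable) :
    ∃ (a : ℕ → E₁) (b : ℕ → E₂),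
      (∀ f N, ∑ n ∈ Finset.range N, ‖⟪a n, f⟫_ℂ‖ ^ 2 ≤ ‖X f‖ ^ 2) ∧
      (∀ g N, ∑ n ∈ Finset.range N, ‖⟪b n, g⟫_ℂ‖ ^ 2 ≤ ‖Y g‖ ^ 2) ∧
      ∀ f g, HasSum (fun n => ⟪f, a n⟫_ℂ * ⟪b n, g⟫_ℂ) ⟪X f, Y g⟫_ℂ := by
  let R : Submodule ℂ E := X.range.topologicalClosure
  have hXR : ∀ f, X f ∈ R := fun f => Submodule.le_topologicalClosure _ ⟨f, rfl⟩
  have hRperp : Rᗮ = (ContinuousLinearMap.adjoint X).ker := by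
    rw [Submodule.orthogonal_closure, ContinuousLinearMap.orthogonal_range]
  have : CompleteSpace R := (Submodule.isClosed_topologicalClosure _).completeSpace_coe
  -- Only the part of `Y` in the closed range of `X` contributes, and its range is separable.
  let Z : E₂ →L[ℂ] E := R.starProjection ∘L Y
  have hZ : {i | Z (e i) ≠ 0}.Countable := he.mono fun i hi h0 =>
    hi (R.starProjection_apply_eq_zero_iff.2 (hRperp ▸ h0))
  obtain ⟨u, hu, husum⟩ :=
    exists_parseval_sequence_of_isSeparable (isSeparable_range_of_countable_ne_zero e hZ)
  refine ⟨fun n => ContinuousLinearMap.adjoint X (u n),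
    fun n => ContinuousLinearMap.adjoint Z (u n), fun f N => ?_, fun g N => ?_, fun f g => ?_⟩
  · simpa only [ContinuousLinearMap.adjoint_inner_left] using hu (X f) N
  · simp only [ContinuousLinearMap.adjoint_inner_left]
    refine (hu (Z g) N).trans ?_
    gcongr
    exact R.norm_starProjection_apply_le (Y g)
  · have hinner : ⟪X f, Z g⟫_ℂ = ⟪X f, Y g⟫_ℂ := by
      rw [ContinuousLinearMap.comp_apply, ← Submodule.inner_starProjection_left_eq_right,
        Submodule.starProjection_eq_self_iff.2 (hXR f)]
    simpa only [ContinuousLinearMap.adjoint_inner_left, ContinuousLinearMap.adjoint_inner_right,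
      hinner] using husum (X f) (Z g) ⟨g, rfl⟩

end SeparableFactorization

/-! ### Pointwise bounds from averages -/

section Averages

variable {Z : Type*} [MeasurableSpace Z] {ρ : Measure Z} [IsFiniteMeasure ρ]

theorem ae_norm_le_of_forall_norm_setIntegral_le {H : Type*} [NormedAddCommGroup H]
    [InnerProductSpace ℂ H] [CompleteSpace H] [TopologicalSpace.SeparableSpace H] {F : Z → H}
    (hF : Integrable F ρ) {C : ℝ} (hC : 0 ≤ C)
    (h : ∀ E, MeasurableSet E → ‖∫ z in E, F z ∂ρ‖ ≤ C * ρ.real E) :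
    ∀ᵐ z ∂ρ, ‖F z‖ ≤ C := by
  have hinner : ∀ v : H, ∀ᵐ z ∂ρ, (⟪v, F z⟫_ℂ).re ≤ ‖v‖ * C := fun v => by
    refine ae_le_of_forall_setIntegral_le (hF.const_inner (𝕜 := ℂ) v).re (integrable_const _)
      fun E hE _ => ?_
    calc ∫ z in E, (⟪v, F z⟫_ℂ).re ∂ρ = (⟪v, ∫ z in E, F z ∂ρ⟫_ℂ).re := by
          rw [← integral_inner hF.integrableOn]
          exact integral_re (hF.const_inner (𝕜 := ℂ) v).integrableOn
      _ ≤ ‖v‖ * ‖∫ z in E, F z ∂ρ‖ := re_inner_le_norm (𝕜 := ℂ) v _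
      _ ≤ ‖v‖ * (C * ρ.real E) := by gcongr; exact h E hE
      _ = ∫ _ in E, ‖v‖ * C ∂ρ := by rw [setIntegral_const, smul_eq_mul]; ring
  filter_upwards [ae_all_iff.2 fun n => hinner (TopologicalSpace.denseSeq H n)] with z hz
  have hall : ∀ v, (⟪v, F z⟫_ℂ).re ≤ ‖v‖ * C := fun v =>
    (TopologicalSpace.denseRange_denseSeq H).induction_on v
      (isClosed_le (by fun_prop) (by fun_prop)) hz
  have hself := hall (F z)
  rw [← RCLike.re_to_complex, inner_self_eq_norm_mul_norm] at hself
  rcases (norm_nonneg (F z)).eq_or_lt with h0 | h0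
  · exact h0 ▸ hC
  · exact le_of_mul_le_mul_left hself h0

theorem ae_sum_norm_sq_le_of_forall_sum_norm_setIntegral_sq_le {ι : Type*} [Fintype ι]
    {a : ι → Z → ℂ} (ha : ∀ i, Integrable (a i) ρ) {C : ℝ} (hC : 0 ≤ C)
    (h : ∀ E, MeasurableSet E → ∑ i, ‖∫ z in E, a i z ∂ρ‖ ^ 2 ≤ (C * ρ.real E) ^ 2) :
    ∀ᵐ z ∂ρ, ∑ i, ‖a i z‖ ^ 2 ≤ C ^ 2 := by
  let F : Z → EuclideanSpace ℂ ι := fun z => WithLp.toLp 2 fun i => a i z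
  have hF : Integrable F ρ := Integrable.of_eval_piLp ha
  have hbound : ∀ E, MeasurableSet E → ‖∫ z in E, F z ∂ρ‖ ≤ C * ρ.real E := fun E hE => by
    refine (sq_le_sq₀ (norm_nonneg _) (by positivity)).1 ?_
    rw [EuclideanSpace.norm_sq_eq]
    refine (Finset.sum_congr rfl fun i _ => ?_).trans_le (h E hE)
    rw [eval_integral_piLp (f := F) fun i => (ha i).integrableOn]
  filter_upwards [ae_norm_le_of_forall_norm_setIntegral_le hF hC hbound] with z hz
  rw [← EuclideanSpace.norm_sq_eq (F z)]
  gcongr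

theorem ae_tsum_enorm_sq_le_of_forall_sum_norm_inner_indicatorL2_sq_le {a : ℕ → Lp ℂ 2 ρ} {C : ℝ}
    (hC : 0 ≤ C) (h : ∀ E (hE : MeasurableSet E) N,
      ∑ n ∈ Finset.range N, ‖⟪a n, indicatorL2 ρ hE⟫_ℂ‖ ^ 2 ≤ (C * ρ.real E) ^ 2) :
    ∀ᵐ z ∂ρ, ∑' n, ‖a n z‖ₑ ^ 2 ≤ ENNReal.ofReal (C ^ 2) := by
  have hfin : ∀ N, ∀ᵐ z ∂ρ, ∑ n : Fin N, ‖a n z‖ ^ 2 ≤ C ^ 2 := fun N => by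
    refine ae_sum_norm_sq_le_of_forall_sum_norm_setIntegral_sq_le (a := fun n : Fin N => a n)
      (fun n => (Lp.memLp (a n)).integrable one_le_two) hC fun E hE => ?_
    refine le_of_eq_of_le ?_ (h E hE N)
    rw [Fin.sum_univ_eq_sum_range fun n => ‖∫ z in E, a n z ∂ρ‖ ^ 2]
    refine Finset.sum_congr rfl fun n _ => ?_
    rw [← inner_indicatorL2 hE, norm_inner_symm]
  filter_upwards [ae_all_iff.2 hfin] with z hz
  refine ENNReal.tsum_le_of_sum_range_le fun N => ?_
  simp only [← ofReal_norm, ← ENNReal.ofReal_pow (norm_nonneg _)]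
  rw [← ENNReal.ofReal_sum_of_nonneg fun _ _ => by positivity,
    ← Fin.sum_univ_eq_sum_range fun n => ‖a n z‖ ^ 2]
  exact ENNReal.ofReal_le_ofReal (hz N)

end Averages

/-! ### Dominated series of functions -/

section Series

theorem tsum_mul_le_of_tsum_sq_le {ι : Type*} {x y : ι → ℝ≥0∞} {C : ℝ≥0∞}
    (hx : ∑' n, x n ^ 2 ≤ C) (hy : ∑' n, y n ^ 2 ≤ C) : ∑' n, x n * y n ≤ C := by
  have hyoung : ∀ n, x n * y n ≤ x n ^ 2 / 2 + y n ^ 2 / 2 := fun n => by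
    simpa using ENNReal.young_inequality (x n) (y n) Real.HolderConjugate.two_two
  calc ∑' n, x n * y n ≤ ∑' n, (x n ^ 2 / 2 + y n ^ 2 / 2) := ENNReal.tsum_le_tsum hyoung
    _ = (∑' n, x n ^ 2) / 2 + (∑' n, y n ^ 2) / 2 := by
        simp only [div_eq_mul_inv, ENNReal.tsum_add, ENNReal.tsum_mul_right]
    _ ≤ C / 2 + C / 2 := by gcongr
    _ = C := ENNReal.add_halves C

variable {X : Type*} [MeasurableSpace X] {m : Measure X} {E : Type*} [NormedAddCommGroup E]
  {F : ℕ → X → E} {f : X → E} {g : X → ℝ}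

theorem aestronglyMeasurable_of_ae_hasSum (hF : ∀ n, AEStronglyMeasurable (F n) m)
    (hf : ∀ᵐ x ∂m, HasSum (fun n => F n x) (f x)) : AEStronglyMeasurable f m :=
  aestronglyMeasurable_of_tendsto_ae Filter.atTop
    (fun N => Finset.aestronglyMeasurable_fun_sum (Finset.range N) fun n _ => hF n)
    (hf.mono fun _ hx => hx.tendsto_sum_nat)

theorem integrable_of_hasSum_of_tsum_enorm_le (hF : ∀ n, AEStronglyMeasurable (F n) m)
    (hg : Integrable g m) (hFg : ∀ᵐ x ∂m, ∑' n, ‖F n x‖ₑ ≤ ‖g x‖ₑ)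
    (hf : ∀ᵐ x ∂m, HasSum (fun n => F n x) (f x)) : Integrable f m := by
  refine ⟨aestronglyMeasurable_of_ae_hasSum hF hf, (lintegral_mono_ae ?_).trans_lt hg.2⟩
  filter_upwards [hFg, hf] with x hx hxf
  rw [← hxf.tsum_eq]
  exact enorm_tsum_le_tsum_enorm.trans hx

theorem hasSum_integral_of_tsum_enorm_le [NormedSpace ℝ E]
    (hF : ∀ n, AEStronglyMeasurable (F n) m) (hg : Integrable g m)
    (hFg : ∀ᵐ x ∂m, ∑' n, ‖F n x‖ₑ ≤ ‖g x‖ₑ)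
    (hf : ∀ᵐ x ∂m, HasSum (fun n => F n x) (f x)) :
    HasSum (fun n => ∫ x, F n x ∂m) (∫ x, f x ∂m) := by
  have hsum : ∑' n, ∫⁻ x, ‖F n x‖ₑ ∂m ≠ ∞ := by
    rw [← lintegral_tsum fun n => (hF n).enorm]
    exact ((lintegral_mono_ae hFg).trans_lt hg.2).ne
  have hint : ∀ n, Integrable (F n) m := fun n =>
    ⟨hF n, (ENNReal.le_tsum n).trans_lt hsum.lt_top⟩
  rw [integral_congr_ae (hf.mono fun x hx => hx.tsum_eq.symm)]
  refine hasSum_integral_of_summable_integral_norm hint ?_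
  simpa only [integral_norm_eq_lintegral_enorm (hF _)] using ENNReal.summable_toReal hsum

end Series

section Rectangles

variable {X Y : Type*} [MeasurableSpace X] [MeasurableSpace Y] {μ : Measure X} {ν : Measure Y}
  [IsFiniteMeasure μ] [IsFiniteMeasure ν] {E : Type*} [NormedAddCommGroup E] [NormedSpace ℝ E]
  [CompleteSpace E]

theorem ae_eq_of_forall_setIntegral_prod_eq {f g : X × Y → E} (hf : Integrable f (μ.prod ν))
    (hg : Integrable g (μ.prod ν))
    (h : ∀ A B, MeasurableSet A → MeasurableSet B →
      ∫ x in A ×ˢ B, f x ∂μ.prod ν = ∫ x in A ×ˢ B, g x ∂μ.prod ν) : f =ᵐ[μ.prod ν] g := by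
  have huniv : ∫ x, f x ∂μ.prod ν = ∫ x, g x ∂μ.prod ν := by
    simpa using h Set.univ Set.univ MeasurableSet.univ MeasurableSet.univ
  refine hf.ae_eq_of_forall_setIntegral_eq _ _ hg fun s hs _ => ?_
  induction s, hs using MeasurableSpace.induction_on_inter generateFrom_prod.symm
    isPiSystem_prod with
  | empty => simp
  | basic t ht =>
    obtain ⟨A, hA, B, hB, rfl⟩ := ht
    exact h A B hA hB
  | compl t ht ih =>
    have hadd := integral_add_compl ht hf
    rw [ih (measure_lt_top _ _), huniv, ← integral_add_compl ht hg] at hadd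
    exact add_left_cancel hadd
  | iUnion A hA hAm ih =>
    rw [integral_iUnion hAm hA hf.integrableOn, integral_iUnion hAm hA hg.integrableOn]
    exact tsum_congr fun i => ih i (measure_lt_top _ _)

theorem ae_hasSum_of_forall_hasSum_setIntegral_prod {F : ℕ → X × Y → E} {f : X × Y → E}
    {g : X × Y → ℝ} (hF : ∀ n, AEStronglyMeasurable (F n) (μ.prod ν))
    (hg : Integrable g (μ.prod ν)) (hFg : ∀ᵐ z ∂μ.prod ν, ∑' n, ‖F n z‖ₑ ≤ ‖g z‖ₑ)
    (hf : Integrable f (μ.prod ν))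
    (h : ∀ A B, MeasurableSet A → MeasurableSet B →
      HasSum (fun n => ∫ z in A ×ˢ B, F n z ∂μ.prod ν) (∫ z in A ×ˢ B, f z ∂μ.prod ν)) :
    ∀ᵐ z ∂μ.prod ν, HasSum (fun n => F n z) (f z) := by
  have hsum : ∀ᵐ z ∂μ.prod ν, HasSum (fun n => F n z) (∑' n, F n z) := by
    filter_upwards [hFg] with z hz
    refine (Summable.of_norm ?_).hasSum
    simpa using ENNReal.summable_toReal (hz.trans_lt enorm_lt_top).ne
  have heq : f =ᵐ[μ.prod ν] fun z => ∑' n, F n z := by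
    refine ae_eq_of_forall_setIntegral_prod_eq hf
      (integrable_of_hasSum_of_tsum_enorm_le hF hg hFg hsum) fun A B hA hB => ?_
    exact (h A B hA hB).unique (hasSum_integral_of_tsum_enorm_le (fun n => (hF n).restrict)
      hg.integrableOn (ae_restrict_of_ae hFg) (ae_restrict_of_ae hsum))
  filter_upwards [hsum, heq] with z hz hfz
  rwa [hfz]

end Rectangles

/-! ### Factorization of measurable Schur multipliers -/

/-- `IsSchurFactorization μ ν Φ C φ ψ` says that `Φ(s,t) = ∑ n, φ n s * ψ n t` almost everywhere,
with measurable factors such that `∑ n, |φ n|² ≤ C` and `∑ n, |ψ n|² ≤ C` almost everywhere. -/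
structure IsSchurFactorization {S : Type u} {T : Type v} [MeasurableSpace S] [MeasurableSpace T]
    (μ : Measure S) (ν : Measure T) (Φ : S × T → ℂ) (C : ℝ≥0∞) (φ : ℕ → S → ℂ)
    (ψ : ℕ → T → ℂ) : Prop where
  aestronglyMeasurable_left : ∀ n, AEStronglyMeasurable (φ n) μ
  aestronglyMeasurable_right : ∀ n, AEStronglyMeasurable (ψ n) ν
  ae_hasSum : ∀ᵐ z ∂μ.prod ν, HasSum (fun n => φ n z.1 * ψ n z.2) (Φ z)
  ae_tsum_left_le : ∀ᵐ s ∂μ, ∑' n, ‖φ n s‖ₑ ^ 2 ≤ C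
  ae_tsum_right_le : ∀ᵐ t ∂ν, ∑' n, ‖ψ n t‖ₑ ^ 2 ≤ C

section Factorization

variable {S : Type u} {T : Type v} [MeasurableSpace S] [MeasurableSpace T]
  {μ : Measure S} {ν : Measure T} {Φ : S × T → ℂ} {C : ℝ≥0∞} {φ : ℕ → S → ℂ} {ψ : ℕ → T → ℂ}

theorem memLp_top_of_ae_tsum_enorm_sq_le (hφ : ∀ n, AEStronglyMeasurable (φ n) μ)
    (hC : C ≠ ∞) (h : ∀ᵐ s ∂μ, ∑' n, ‖φ n s‖ₑ ^ 2 ≤ C) (n : ℕ) : MemLp (φ n) ∞ μ := by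
  refine memLp_top_of_bound (hφ n) (√C.toReal) ?_
  filter_upwards [h] with s hs
  refine Real.le_sqrt_of_sq_le ?_
  rw [← toReal_enorm, ← ENNReal.toReal_pow]
  exact ENNReal.toReal_mono hC ((ENNReal.le_tsum n).trans hs)

theorem ae_tsum_enorm_mul_le [SFinite ν] (hφ : ∀ᵐ s ∂μ, ∑' n, ‖φ n s‖ₑ ^ 2 ≤ C)
    (hψ : ∀ᵐ t ∂ν, ∑' n, ‖ψ n t‖ₑ ^ 2 ≤ C) :
    ∀ᵐ z ∂μ.prod ν, ∑' n, ‖φ n z.1 * ψ n z.2‖ₑ ≤ C := by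
  filter_upwards [Measure.quasiMeasurePreserving_fst.ae hφ,
    Measure.quasiMeasurePreserving_snd.ae hψ] with z hz1 hz2
  simp only [enorm_mul]
  exact tsum_mul_le_of_tsum_sq_le hz1 hz2

namespace IsSchurFactorization

theorem memLp_left (h : IsSchurFactorization μ ν Φ C φ ψ) (hC : C ≠ ∞) (n : ℕ) :
    MemLp (φ n) ∞ μ :=
  memLp_top_of_ae_tsum_enorm_sq_le h.aestronglyMeasurable_left hC h.ae_tsum_left_le n

theorem memLp_right (h : IsSchurFactorization μ ν Φ C φ ψ) (hC : C ≠ ∞) (n : ℕ) :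
    MemLp (ψ n) ∞ ν :=
  memLp_top_of_ae_tsum_enorm_sq_le h.aestronglyMeasurable_right hC h.ae_tsum_right_le n

theorem mono_ac {μ' : Measure S} {ν' : Measure T} [SFinite ν']
    (h : IsSchurFactorization μ' ν' Φ C φ ψ) (hμ : μ ≪ μ') (hν : ν ≪ ν') :
    IsSchurFactorization μ ν Φ C φ ψ where
  aestronglyMeasurable_left n := (h.aestronglyMeasurable_left n).mono_ac hμ
  aestronglyMeasurable_right n := (h.aestronglyMeasurable_right n).mono_ac hν
  ae_hasSum := (hμ.prod hν).ae_le h.ae_hasSum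
  ae_tsum_left_le := hμ.ae_le h.ae_tsum_left_le
  ae_tsum_right_le := hν.ae_le h.ae_tsum_right_le

theorem of_hasSum_inner_indicatorL2 [IsFiniteMeasure μ] [IsFiniteMeasure ν] {a : ℕ → Lp ℂ 2 μ}
    {b : ℕ → Lp ℂ 2 ν} {C : ℝ} (hC : 0 ≤ C)
    (ha : ∀ᵐ s ∂μ, ∑' n, ‖a n s‖ₑ ^ 2 ≤ ENNReal.ofReal C)
    (hb : ∀ᵐ t ∂ν, ∑' n, ‖b n t‖ₑ ^ 2 ≤ ENNReal.ofReal C) (hΦ : Integrable Φ (μ.prod ν))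
    (h : ∀ E G (hE : MeasurableSet E) (hG : MeasurableSet G),
      HasSum (fun n => ⟪indicatorL2 μ hE, a n⟫_ℂ * ⟪b n, indicatorL2 ν hG⟫_ℂ)
        (∫ z in E ×ˢ G, Φ z ∂μ.prod ν)) :
    IsSchurFactorization μ ν Φ (ENNReal.ofReal C) (fun n => a n) (fun n => star (b n)) := by
  have hbm : ∀ n, AEStronglyMeasurable (star (b n : T → ℂ)) ν := fun n =>
    (Lp.aestronglyMeasurable (b n)).star
  have hb' : ∀ᵐ t ∂ν, ∑' n, ‖star (b n : T → ℂ) t‖ₑ ^ 2 ≤ ENNReal.ofReal C := by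
    simpa only [Pi.star_apply, Complex.star_def, RCLike.enorm_conj] using hb
  refine ⟨fun n => Lp.aestronglyMeasurable (a n), hbm, ?_, ha, hb'⟩
  refine ae_hasSum_of_forall_hasSum_setIntegral_prod (g := fun _ => C)
    (fun n => (Lp.aestronglyMeasurable (a n)).comp_fst.mul (hbm n).comp_snd)
    (integrable_const C) ?_ hΦ fun E G hE hG => ?_
  · simpa only [Real.enorm_of_nonneg hC] using ae_tsum_enorm_mul_le ha hb'
  · refine (h E G hE hG).congr_fun fun n => ?_
    rw [setIntegral_prod_mul, inner_indicatorL2, ← inner_conj_symm, inner_indicatorL2,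
      ← integral_conj]
    rfl

end IsSchurFactorization

theorem exists_isSchurFactorization_of_isFiniteMeasure [IsFiniteMeasure μ] [IsFiniteMeasure ν]
    (hΦ : IsDiscreteSchurMultiplier Φ) (hmeas : AEMeasurable Φ (μ.prod ν)) :
    ∃ φ ψ, IsSchurFactorization μ ν Φ (ENNReal.ofReal (discreteSchurNorm Φ)) φ ψ := by
  obtain ⟨X, Y, hX, hY, hXY⟩ := exists_clm_inner_indicatorL2_eq_setIntegral hΦ hmeas
  have hc := discreteSchurNorm_nonneg Φ
  have hΦ2 : MemLp Φ 2 (μ.prod ν) :=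
    MemLp.of_bound hmeas.aestronglyMeasurable _ (.of_forall (norm_le_discreteSchurNorm hΦ))
  have hop : ContinuousLinearMap.adjoint X ∘L Y = integralOperator μ ν Φ hΦ2 :=
    clm_ext_inner_indicatorL2 fun E G hE hG => by
      rw [ContinuousLinearMap.comp_apply, ContinuousLinearMap.adjoint_inner_right, hXY,
        inner_indicatorL2_integralOperator_indicatorL2]
  obtain ⟨w, e, -⟩ := exists_hilbertBasis ℂ (Lp ℂ 2 ν)
  have he := countable_setOf_integralOperator_ne_zero e hΦ2
  rw [← hop] at he
  obtain ⟨a, b, ha, hb, hab⟩ := exists_hasSum_inner_mul_inner X Y e he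
  have ha' := ae_tsum_enorm_sq_le_of_forall_sum_norm_inner_indicatorL2_sq_le
    (Real.sqrt_nonneg _) fun E hE N => (ha (indicatorL2 μ hE) N).trans
      (pow_le_pow_left₀ (norm_nonneg _) (hX E hE) 2)
  have hb' := ae_tsum_enorm_sq_le_of_forall_sum_norm_inner_indicatorL2_sq_le
    (Real.sqrt_nonneg _) fun G hG N => (hb (indicatorL2 ν hG) N).trans
      (pow_le_pow_left₀ (norm_nonneg _) (hY G hG) 2)
  rw [Real.sq_sqrt hc] at ha' hb'
  exact ⟨_, _, .of_hasSum_inner_indicatorL2 hc ha' hb' (hΦ2.integrable one_le_two)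
    fun E G hE hG => hXY E G hE hG ▸ hab _ _⟩

theorem exists_isSchurFactorization [SFinite μ] [SFinite ν]
    (hΦ : IsDiscreteSchurMultiplier Φ) (hmeas : AEMeasurable Φ (μ.prod ν)) :
    ∃ φ ψ, IsSchurFactorization μ ν Φ (ENNReal.ofReal (discreteSchurNorm Φ)) φ ψ := by
  obtain ⟨μ', hμ', hμμ', hμ'μ⟩ := exists_isFiniteMeasure_absolutelyContinuous μ
  obtain ⟨ν', hν', hνν', hν'ν⟩ := exists_isFiniteMeasure_absolutelyContinuous ν
  obtain ⟨φ, ψ, hφψ⟩ := exists_isSchurFactorization_of_isFiniteMeasure (μ := μ') (ν := ν') hΦ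
    (hmeas.mono_ac (hμ'μ.prod hν'ν))
  exact ⟨φ, ψ, hφψ.mono_ac hμμ' hνν'⟩

end Factorization

/-! ### Trace norm estimates -/

section Douglas

variable {𝕜 E F G : Type*} [RCLike 𝕜] [AddCommGroup E] [Module 𝕜 E]
  [NormedAddCommGroup F] [NormedSpace 𝕜 F] [CompleteSpace F]
  [NormedAddCommGroup G] [InnerProductSpace 𝕜 G] [CompleteSpace G]

-- Douglas' lemma: `B x ↦ A x` is a well-defined contraction on the closure of the range of `B`.
theorem exists_norm_le_one_apply_eq (A : E →ₗ[𝕜] F) (B : E →ₗ[𝕜] G) (h : ∀ x, ‖A x‖ ≤ ‖B x‖) :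
    ∃ U : G →L[𝕜] F, ‖U‖ ≤ 1 ∧ ∀ x, U (B x) = A x := by
  let R : Submodule 𝕜 G := B.range.topologicalClosure
  have : CompleteSpace R := B.range.isClosed_topologicalClosure.completeSpace_coe
  let e : E →ₗ[𝕜] R := B.codRestrict R fun x => B.range.le_topologicalClosure ⟨x, rfl⟩
  have he : DenseRange e :=
    ((denseRange_inclusion_iff subset_closure).2 subset_rfl).comp
      B.surjective_rangeRestrict.denseRange (continuous_inclusion subset_closure)
  have hnorm : ∀ x, ‖A x‖ ≤ 1 * ‖e x‖ := fun x => (h x).trans_eq (one_mul _).symm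
  refine ⟨A.extendOfNorm e ∘L R.orthogonalProjectionOnto, ?_, fun x => ?_⟩
  · calc ‖A.extendOfNorm e ∘L R.orthogonalProjectionOnto‖
        ≤ ‖A.extendOfNorm e‖ * ‖R.orthogonalProjectionOnto‖ :=
          ContinuousLinearMap.opNorm_comp_le _ _
      _ ≤ 1 * 1 := by
          gcongr
          · exact LinearMap.opNorm_extendOfNorm_le he zero_le_one hnorm
          · exact R.orthogonalProjectionOnto_norm_le
      _ = 1 := one_mul 1
  · rw [ContinuousLinearMap.comp_apply, ← LinearMap.extendOfNorm_eq he ⟨1, hnorm⟩ x]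
    exact congrArg _ (Submodule.orthogonalProjectionOnto_mem_subspace_eq_self (e x))

theorem enorm_apply_le_of_norm_le_one {E F : Type*} [SeminormedAddCommGroup E] [NormedSpace 𝕜 E]
    [SeminormedAddCommGroup F] [NormedSpace 𝕜 F] {U : E →L[𝕜] F} (hU : ‖U‖ ≤ 1) (x : E) :
    ‖U x‖ₑ ≤ ‖x‖ₑ := by
  rw [enorm_le_iff_norm_le]
  simpa using U.le_of_opNorm_le hU x

end Douglas

section HilbertSchmidt

variable {E F : Type*} [NormedAddCommGroup E] [InnerProductSpace ℂ E] [CompleteSpace E]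
  [NormedAddCommGroup F] [InnerProductSpace ℂ F] [CompleteSpace F]

theorem tsum_enorm_apply_sq_eq_tsum_enorm_adjoint_apply_sq {ι κ : Type*} (e : HilbertBasis ι ℂ E)
    (f : HilbertBasis κ ℂ F) (R : E →L[ℂ] F) :
    ∑' i, ‖R (e i)‖ₑ ^ 2 = ∑' j, ‖ContinuousLinearMap.adjoint R (f j)‖ₑ ^ 2 := by
  calc ∑' i, ‖R (e i)‖ₑ ^ 2 = ∑' i, ∑' j, ‖⟪f j, R (e i)⟫_ℂ‖ₑ ^ 2 := by
        simp only [parseval_enorm f]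
    _ = ∑' j, ∑' i, ‖⟪f j, R (e i)⟫_ℂ‖ₑ ^ 2 := ENNReal.tsum_comm
    _ = ∑' j, ∑' i, ‖⟪e i, ContinuousLinearMap.adjoint R (f j)⟫_ℂ‖ₑ ^ 2 := by
        refine tsum_congr fun j => tsum_congr fun i => ?_
        rw [← ContinuousLinearMap.adjoint_inner_left, ← inner_conj_symm, RCLike.enorm_conj]
    _ = ∑' j, ‖ContinuousLinearMap.adjoint R (f j)‖ₑ ^ 2 := by simp only [parseval_enorm e]

end HilbertSchmidt

section OpAbs

variable {E : Type u} {F : Type v}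
  [NormedAddCommGroup E] [InnerProductSpace ℂ E] [CompleteSpace E]
  [NormedAddCommGroup F] [InnerProductSpace ℂ F] [CompleteSpace F]

theorem isPositive_opAbs (A : E →L[ℂ] F) : (opAbs A).IsPositive :=
  (ContinuousLinearMap.nonneg_iff_isPositive _).1 (CFC.sqrt_nonneg _)

theorem norm_opAbs_apply (A : E →L[ℂ] F) (x : E) : ‖opAbs A x‖ = ‖A x‖ := by
  have hinner : ⟪opAbs A x, opAbs A x⟫_ℂ = ⟪A x, A x⟫_ℂ := by
    rw [opAbs, inner_sqrt_sqrt_of_isPositive A.isPositive_adjoint_comp_self,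
      ContinuousLinearMap.comp_apply, ContinuousLinearMap.adjoint_inner_left]
  rw [norm_eq_sqrt_re_inner (𝕜 := ℂ), norm_eq_sqrt_re_inner (𝕜 := ℂ), hinner]

theorem exists_apply_opAbs_eq (A : E →L[ℂ] F) :
    ∃ U : E →L[ℂ] F, ‖U‖ ≤ 1 ∧ ∀ x, U (opAbs A x) = A x :=
  exists_norm_le_one_apply_eq A.toLinearMap (opAbs A).toLinearMap
    fun x => (norm_opAbs_apply A x).ge

theorem exists_apply_eq_opAbs (A : E →L[ℂ] F) :
    ∃ W : F →L[ℂ] E, ‖W‖ ≤ 1 ∧ ∀ x, W (A x) = opAbs A x :=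
  exists_norm_le_one_apply_eq (opAbs A).toLinearMap A.toLinearMap
    fun x => (norm_opAbs_apply A x).le

theorem traceNorm_eq_tsum_enorm_sqrt_opAbs_sq {ι : Type*} (e : HilbertBasis ι ℂ E)
    (A : E →L[ℂ] F) : traceNorm A = ∑' i, ‖CFC.sqrt (opAbs A) (e i)‖ₑ ^ 2 := by
  rw [traceNorm_eq e]
  refine tsum_congr fun i => ?_
  rw [← (isPositive_opAbs A).inner_left_eq_inner_right,
    ← inner_sqrt_sqrt_of_isPositive (isPositive_opAbs A), inner_self_eq_norm_sq,
    ENNReal.ofReal_pow (norm_nonneg _), ofReal_norm]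

theorem traceNorm_le_tsum_enorm_inner {ι : Type*} (e : HilbertBasis ι ℂ E) (A : E →L[ℂ] F) :
    traceNorm A ≤ ∑' i, ‖⟪e i, opAbs A (e i)⟫_ℂ‖ₑ := by
  rw [traceNorm_eq e]
  refine ENNReal.tsum_le_tsum fun i => ?_
  rw [← ofReal_norm]
  exact ENNReal.ofReal_le_ofReal (RCLike.re_le_norm _)

theorem tsum_tsum_enorm_apply_sq_le {G : Type*} [NormedAddCommGroup G] [InnerProductSpace ℂ G]
    [CompleteSpace G] {ι κ : Type*} (g : HilbertBasis κ ℂ G) (A : E →L[ℂ] F) {R : ι → G →L[ℂ] E}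
    {C : ℝ≥0∞} (hR : ∀ x, ∑' n, ‖ContinuousLinearMap.adjoint (R n) x‖ₑ ^ 2 ≤
      C * ‖CFC.sqrt (opAbs A) x‖ₑ ^ 2) :
    ∑' j, ∑' n, ‖R n (g j)‖ₑ ^ 2 ≤ C * traceNorm A := by
  obtain ⟨w, e, -⟩ := exists_hilbertBasis ℂ E
  calc ∑' j, ∑' n, ‖R n (g j)‖ₑ ^ 2 = ∑' n, ∑' j, ‖R n (g j)‖ₑ ^ 2 := ENNReal.tsum_comm
    _ = ∑' n, ∑' i, ‖ContinuousLinearMap.adjoint (R n) (e i)‖ₑ ^ 2 :=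
        tsum_congr fun n => tsum_enorm_apply_sq_eq_tsum_enorm_adjoint_apply_sq g e (R n)
    _ = ∑' i, ∑' n, ‖ContinuousLinearMap.adjoint (R n) (e i)‖ₑ ^ 2 := ENNReal.tsum_comm
    _ ≤ ∑' i, C * ‖CFC.sqrt (opAbs A) (e i)‖ₑ ^ 2 := ENNReal.tsum_le_tsum fun i => hR (e i)
    _ = C * traceNorm A := by
        rw [ENNReal.tsum_mul_left, traceNorm_eq_tsum_enorm_sqrt_opAbs_sq e]

theorem adjoint_sqrt_opAbs (A : E →L[ℂ] F) :
    ContinuousLinearMap.adjoint (CFC.sqrt (opAbs A)) = CFC.sqrt (opAbs A) :=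
  (CFC.sqrt_nonneg (opAbs A)).isSelfAdjoint.adjoint_eq

theorem enorm_inner_apply_le_of_apply_opAbs_eq {A U : E →L[ℂ] F} (hU : ∀ x, U (opAbs A x) = A x)
    (y : F) (x : E) : ‖⟪y, A x⟫_ℂ‖ₑ ≤
      ‖CFC.sqrt (opAbs A) (ContinuousLinearMap.adjoint U y)‖ₑ * ‖CFC.sqrt (opAbs A) x‖ₑ := by
  rw [← hU, ← ContinuousLinearMap.adjoint_inner_left,
    ← (isPositive_opAbs A).inner_left_eq_inner_right,
    ← inner_sqrt_sqrt_of_isPositive (isPositive_opAbs A), ← ofReal_norm, ← ofReal_norm,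
    ← ofReal_norm, ← ENNReal.ofReal_mul (norm_nonneg _)]
  exact ENNReal.ofReal_le_ofReal (norm_inner_le_norm _ _)

-- `B = ∑ n, (Y n)* A (X n)` weakly; polar decomposition splits each term of the trace of `|B|`
-- into a product of two Hilbert–Schmidt terms.
theorem traceNorm_le_of_hasSum {G : Type*} {K : Type*} [NormedAddCommGroup G]
    [InnerProductSpace ℂ G] [CompleteSpace G] [NormedAddCommGroup K] [InnerProductSpace ℂ K]
    [CompleteSpace K] {ι : Type*} {A : E →L[ℂ] F} {B : G →L[ℂ] K} {X : ι → G →L[ℂ] E}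
    {Y : ι → K →L[ℂ] F} {C : ℝ≥0∞}
    (hX : ∀ x, ∑' n, ‖ContinuousLinearMap.adjoint (X n) x‖ₑ ^ 2 ≤ C * ‖x‖ₑ ^ 2)
    (hY : ∀ y, ∑' n, ‖ContinuousLinearMap.adjoint (Y n) y‖ₑ ^ 2 ≤ C * ‖y‖ₑ ^ 2)
    (h : ∀ x y, HasSum (fun n => ⟪Y n y, A (X n x)⟫_ℂ) ⟪y, B x⟫_ℂ) :
    traceNorm B ≤ C * traceNorm A := by
  obtain ⟨w, g, -⟩ := exists_hilbertBasis ℂ G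
  obtain ⟨U, hU, hUA⟩ := exists_apply_opAbs_eq A
  obtain ⟨W, hW, hWB⟩ := exists_apply_eq_opAbs B
  let Q := CFC.sqrt (opAbs A)
  let V := ContinuousLinearMap.adjoint W
  let P n := Q ∘L X n
  let R n := Q ∘L ContinuousLinearMap.adjoint U ∘L Y n ∘L V
  have hP : ∑' j, ∑' n, ‖P n (g j)‖ₑ ^ 2 ≤ C * traceNorm A := by
    refine tsum_tsum_enorm_apply_sq_le g A fun x => ?_
    simpa only [P, Q, ContinuousLinearMap.adjoint_comp, adjoint_sqrt_opAbs,
      ContinuousLinearMap.comp_apply] using hX (Q x)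
  have hR : ∑' j, ∑' n, ‖R n (g j)‖ₑ ^ 2 ≤ C * traceNorm A := by
    refine tsum_tsum_enorm_apply_sq_le g A fun x => ?_
    simp only [R, Q, V, ContinuousLinearMap.adjoint_comp, adjoint_sqrt_opAbs,
      ContinuousLinearMap.adjoint_adjoint, ContinuousLinearMap.comp_apply]
    calc ∑' n, ‖W (ContinuousLinearMap.adjoint (Y n) (U (Q x)))‖ₑ ^ 2
        ≤ ∑' n, ‖ContinuousLinearMap.adjoint (Y n) (U (Q x))‖ₑ ^ 2 :=
          ENNReal.tsum_le_tsum fun n => by gcongr; exact enorm_apply_le_of_norm_le_one hW _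
      _ ≤ C * ‖U (Q x)‖ₑ ^ 2 := hY _
      _ ≤ C * ‖Q x‖ₑ ^ 2 := by gcongr; exact enorm_apply_le_of_norm_le_one hU _
  have hterm : ∀ j, ‖⟪g j, opAbs B (g j)⟫_ℂ‖ₑ ≤ ∑' n, ‖R n (g j)‖ₑ * ‖P n (g j)‖ₑ := fun j => by
    rw [← hWB, ← ContinuousLinearMap.adjoint_inner_left, ← (h (g j) (V (g j))).tsum_eq]
    exact enorm_tsum_le_tsum_enorm.trans
      (ENNReal.tsum_le_tsum fun n => enorm_inner_apply_le_of_apply_opAbs_eq hUA _ _)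
  refine (traceNorm_le_tsum_enorm_inner g B).trans ((ENNReal.tsum_le_tsum hterm).trans ?_)
  rw [← ENNReal.tsum_prod] at hP hR ⊢
  exact tsum_mul_le_of_tsum_sq_le hR hP

end OpAbs

/-! ### Integral operators with kernel `Φ h` -/

section MulL2

variable {S : Type*} [MeasurableSpace S] {m : Measure S}

/-- Multiplication by an essentially bounded function, as a bounded operator on `L²`. -/
def mulL2 {φ : S → ℂ} (hφ : MemLp φ ∞ m) : Lp ℂ 2 m →L[ℂ] Lp ℂ 2 m :=
  (ContinuousLinearMap.mul ℂ ℂ).holderL m ∞ 2 2 (hφ.toLp φ)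

theorem coeFn_mulL2 {φ : S → ℂ} (hφ : MemLp φ ∞ m) (f : Lp ℂ 2 m) :
    mulL2 hφ f =ᵐ[m] fun s => φ s * f s := by
  filter_upwards [(ContinuousLinearMap.mul ℂ ℂ).coeFn_holder (r := 2) (hφ.toLp φ) f,
    hφ.coeFn_toLp] with s hs hφs
  rw [mulL2, ContinuousLinearMap.holderL_apply_apply, hs, hφs, ContinuousLinearMap.mul_apply']

theorem adjoint_mulL2 {φ : S → ℂ} (hφ : MemLp φ ∞ m) :
    ContinuousLinearMap.adjoint (mulL2 hφ) = mulL2 hφ.star := by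
  refine ((ContinuousLinearMap.eq_adjoint_iff _ _).2 fun f g => ?_).symm
  rw [L2.inner_def, L2.inner_def]
  refine integral_congr_ae ?_
  filter_upwards [coeFn_mulL2 hφ g, coeFn_mulL2 hφ.star f] with s hg hf
  rw [hg, hf]
  simp only [RCLike.inner_apply, Pi.star_apply, Complex.star_def, map_mul, Complex.conj_conj]
  ring

theorem enorm_mulL2_apply_sq {φ : S → ℂ} (hφ : MemLp φ ∞ m) (f : Lp ℂ 2 m) :
    ‖mulL2 hφ f‖ₑ ^ 2 = ∫⁻ s, ‖φ s‖ₑ ^ 2 * ‖f s‖ₑ ^ 2 ∂m := by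
  rw [enorm_sq_eq_lintegral]
  refine lintegral_congr_ae ?_
  filter_upwards [coeFn_mulL2 hφ f] with s hs
  rw [hs, enorm_mul, mul_pow]

theorem tsum_enorm_mulL2_apply_sq_le {ι : Type*} [Countable ι] {φ : ι → S → ℂ} {C : ℝ≥0∞}
    (hφ : ∀ n, MemLp (φ n) ∞ m) (h : ∀ᵐ s ∂m, ∑' n, ‖φ n s‖ₑ ^ 2 ≤ C) (f : Lp ℂ 2 m) :
    ∑' n, ‖mulL2 (hφ n) f‖ₑ ^ 2 ≤ C * ‖f‖ₑ ^ 2 := by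
  have hf : AEMeasurable (fun s => ‖f s‖ₑ ^ 2) m := (Lp.aestronglyMeasurable f).enorm.pow_const 2
  calc ∑' n, ‖mulL2 (hφ n) f‖ₑ ^ 2 = ∫⁻ s, ∑' n, ‖φ n s‖ₑ ^ 2 * ‖f s‖ₑ ^ 2 ∂m := by
        refine Eq.trans ?_ (lintegral_tsum fun n => ((hφ n).1.enorm.pow_const 2).mul hf).symm
        exact tsum_congr fun n => enorm_mulL2_apply_sq (hφ n) f
    _ ≤ ∫⁻ s, C * ‖f s‖ₑ ^ 2 ∂m := by
        refine lintegral_mono_ae (h.mono fun s hs => ?_)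
        rw [ENNReal.tsum_mul_right]
        gcongr
    _ = C * ‖f‖ₑ ^ 2 := by rw [lintegral_const_mul'' _ hf, enorm_sq_eq_lintegral]

end MulL2

namespace IsSchurFactorization

variable {S : Type u} {T : Type v} [MeasurableSpace S] [MeasurableSpace T]
  {μ : Measure S} {ν : Measure T} {Φ : S × T → ℂ} {C : ℝ≥0∞} {φ : ℕ → S → ℂ} {ψ : ℕ → T → ℂ}

theorem ae_enorm_le [SFinite ν] (hφψ : IsSchurFactorization μ ν Φ C φ ψ) :
    ∀ᵐ z ∂μ.prod ν, ‖Φ z‖ₑ ≤ C := by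
  filter_upwards [hφψ.ae_hasSum, ae_tsum_enorm_mul_le hφψ.ae_tsum_left_le hφψ.ae_tsum_right_le]
    with z hz hle
  rw [← hz.tsum_eq]
  exact enorm_tsum_le_tsum_enorm.trans hle

theorem aestronglyMeasurable_mul [SFinite ν] (hφψ : IsSchurFactorization μ ν Φ C φ ψ) (n : ℕ) :
    AEStronglyMeasurable (fun z : S × T => φ n z.1 * ψ n z.2) (μ.prod ν) :=
  (hφψ.aestronglyMeasurable_left n).comp_fst.mul (hφψ.aestronglyMeasurable_right n).comp_snd

theorem memLp_top [SFinite ν] (hφψ : IsSchurFactorization μ ν Φ C φ ψ) (hC : C ≠ ∞) :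
    MemLp Φ ∞ (μ.prod ν) := by
  have hΦ : AEStronglyMeasurable Φ (μ.prod ν) :=
    aestronglyMeasurable_of_ae_hasSum hφψ.aestronglyMeasurable_mul hφψ.ae_hasSum
  refine memLp_top_of_bound hΦ C.toReal (hφψ.ae_enorm_le.mono fun z hz => ?_)
  rw [← toReal_enorm]
  exact ENNReal.toReal_mono hC hz

theorem hasSum_integral_mul [SFinite ν] (hφψ : IsSchurFactorization μ ν Φ C φ ψ) (hC : C ≠ ∞)
    {k : S × T → ℂ} (hk : Integrable k (μ.prod ν)) :
    HasSum (fun n => ∫ z, φ n z.1 * ψ n z.2 * k z ∂μ.prod ν) (∫ z, Φ z * k z ∂μ.prod ν) := by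
  refine hasSum_integral_of_tsum_enorm_le (g := fun z => C.toReal * ‖k z‖)
    (fun n => (hφψ.aestronglyMeasurable_mul n).mul hk.1)
    (hk.norm.const_mul _) ?_ (hφψ.ae_hasSum.mono fun z hz => hz.mul_right (k z))
  filter_upwards [ae_tsum_enorm_mul_le hφψ.ae_tsum_left_le hφψ.ae_tsum_right_le] with z hz
  simp only [enorm_mul _ (k z), ENNReal.tsum_mul_right]
  rw [enorm_mul, enorm_norm, Real.enorm_of_nonneg ENNReal.toReal_nonneg, ENNReal.ofReal_toReal hC]
  gcongr

variable [SFinite μ] [SFinite ν]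

theorem hasSum_inner_adjoint_mulL2 (hφψ : IsSchurFactorization μ ν Φ C φ ψ) (hC : C ≠ ∞)
    {h : S × T → ℂ} (hh : MemLp h 2 (μ.prod ν)) (hΦh : MemLp (fun z => Φ z * h z) 2 (μ.prod ν))
    (x : Lp ℂ 2 ν) (y : Lp ℂ 2 μ) :
    HasSum (fun n => ⟪ContinuousLinearMap.adjoint (mulL2 (hφψ.memLp_left hC n)) y,
        integralOperator μ ν h hh (mulL2 (hφψ.memLp_right hC n) x)⟫_ℂ)
      ⟪y, integralOperator μ ν (fun z => Φ z * h z) hΦh x⟫_ℂ := by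
  simp only [adjoint_mulL2, inner_integralOperator]
  have hsum := hφψ.hasSum_integral_mul hC (integrable_star_mul_kernel_mul hh y x)
  have hint : ∫ z, Φ z * (star (y z.1) * (h z * x z.2)) ∂μ.prod ν =
      ∫ z, star (y z.1) * (Φ z * h z * x z.2) ∂μ.prod ν := by
    congr 1
    ext z
    ring
  rw [hint] at hsum
  refine hsum.congr_fun fun n => integral_congr_ae ?_
  filter_upwards [Measure.quasiMeasurePreserving_fst.ae
      (coeFn_mulL2 (hφψ.memLp_left hC n).star y),
    Measure.quasiMeasurePreserving_snd.ae (coeFn_mulL2 (hφψ.memLp_right hC n) x)] with z hy hx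
  rw [hy, hx]
  simp only [Pi.star_apply, star_mul, star_star]
  ring

theorem traceNorm_integralOperator_mul_le (hφψ : IsSchurFactorization μ ν Φ C φ ψ) (hC : C ≠ ∞)
    {h : S × T → ℂ} (hh : MemLp h 2 (μ.prod ν)) (hΦh : MemLp (fun z => Φ z * h z) 2 (μ.prod ν)) :
    traceNorm (integralOperator μ ν (fun z => Φ z * h z) hΦh) ≤
      C * traceNorm (integralOperator μ ν h hh) := by
  refine traceNorm_le_of_hasSum (fun x => ?_) (fun y => ?_)
    (hφψ.hasSum_inner_adjoint_mulL2 hC hh hΦh)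
  · simp only [adjoint_mulL2]
    refine tsum_enorm_mulL2_apply_sq_le _ ?_ x
    simpa only [Pi.star_apply, Complex.star_def, RCLike.enorm_conj] using hφψ.ae_tsum_right_le
  · simp only [ContinuousLinearMap.adjoint_adjoint]
    exact tsum_enorm_mulL2_apply_sq_le _ hφψ.ae_tsum_left_le y

theorem kernelTraceNorm_mul_le (hφψ : IsSchurFactorization μ ν Φ C φ ψ) (hC : C ≠ ∞)
    {h : S × T → ℂ} (hh : MemLp h 2 (μ.prod ν)) :
    kernelTraceNorm μ ν (fun z => Φ z * h z) ≤ C * kernelTraceNorm μ ν h := by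
  have hΦh : MemLp (fun z => Φ z * h z) 2 (μ.prod ν) := hh.mul (r := 2) (hφψ.memLp_top hC)
  rw [kernelTraceNorm, kernelTraceNorm, dif_pos hΦh, dif_pos hh]
  exact hφψ.traceNorm_integralOperator_mul_le hC hh hΦh

theorem isSchurMultiplier (hφψ : IsSchurFactorization μ ν Φ C φ ψ) (hC : C ≠ ∞) :
    IsSchurMultiplier μ ν Φ :=
  ⟨(hφψ.memLp_top hC).1.aemeasurable, fun _ hh hfin =>
    (hφψ.kernelTraceNorm_mul_le hC hh).trans_lt (ENNReal.mul_lt_top hC.lt_top hfin)⟩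

theorem schurNorm_le (hφψ : IsSchurFactorization μ ν Φ C φ ψ) (hC : C ≠ ∞) :
    schurNorm μ ν Φ ≤ C :=
  sInf_le fun _ hh => hφψ.kernelTraceNorm_mul_le hC hh

end IsSchurFactorization

end SchurMult

end

theorem mainTheorem4_general {S : Type*} {T : Type*} [MeasurableSpace S] [MeasurableSpace T]
    (μ : Measure S) (ν : Measure T) [SFinite μ] [SFinite ν] (Φ : S × T → ℂ)
    (hΦ : SchurMult.IsDiscreteSchurMultiplier Φ) (hmeas : AEMeasurable Φ (μ.prod ν)) :
    (∃ (φ : ℕ → S → ℂ) (ψ : ℕ → T → ℂ),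
      (∀ n, MemLp (φ n) ∞ μ) ∧ (∀ n, MemLp (ψ n) ∞ ν) ∧
      (∀ᵐ z ∂(μ.prod ν), HasSum (fun n => φ n z.1 * ψ n z.2) (Φ z)) ∧
      (∀ᵐ s ∂μ, ∑' n, ‖φ n s‖ₑ ^ 2 ≤ ENNReal.ofReal (SchurMult.discreteSchurNorm Φ)) ∧
      (∀ᵐ t ∂ν, ∑' n, ‖ψ n t‖ₑ ^ 2 ≤ ENNReal.ofReal (SchurMult.discreteSchurNorm Φ))) ∧
    SchurMult.IsSchurMultiplier μ ν Φ ∧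
    SchurMult.schurNorm μ ν Φ ≤ ENNReal.ofReal (SchurMult.discreteSchurNorm Φ) := by
  obtain ⟨φ, ψ, hφψ⟩ := SchurMult.exists_isSchurFactorization hΦ hmeas
  have hC := ENNReal.ofReal_ne_top (r := SchurMult.discreteSchurNorm Φ)
  exact ⟨⟨φ, ψ, hφψ.memLp_left hC, hφψ.memLp_right hC, hφψ.ae_hasSum, hφψ.ae_tsum_left_le,
    hφψ.ae_tsum_right_le⟩, hφψ.isSchurMultiplier hC, hφψ.schurNorm_le hC⟩

theorem mainTheorem4 {S : Type*} {T : Type*} [MeasurableSpace S] [MeasurableSpace T]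
    (μ : Measure S) (ν : Measure T) [SigmaFinite μ] [SigmaFinite ν] (Φ : S × T → ℂ)
    (hΦ : SchurMult.IsDiscreteSchurMultiplier Φ) (hmeas : AEMeasurable Φ (μ.prod ν)) :
    (∃ (φ : ℕ → S → ℂ) (ψ : ℕ → T → ℂ),
      (∀ n, MemLp (φ n) ∞ μ) ∧ (∀ n, MemLp (ψ n) ∞ ν) ∧
      (∀ᵐ z ∂(μ.prod ν), HasSum (fun n => φ n z.1 * ψ n z.2) (Φ z)) ∧
      (∀ᵐ s ∂μ, ∑' n, ‖φ n s‖ₑ ^ 2 ≤ ENNReal.ofReal (SchurMult.discreteSchurNorm Φ)) ∧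
      (∀ᵐ t ∂ν, ∑' n, ‖ψ n t‖ₑ ^ 2 ≤ ENNReal.ofReal (SchurMult.discreteSchurNorm Φ))) ∧
    SchurMult.IsSchurMultiplier μ ν Φ ∧
    SchurMult.schurNorm μ ν Φ ≤ ENNReal.ofReal (SchurMult.discreteSchurNorm Φ) :=
  mainTheorem4_general μ ν Φ hΦ hmeas
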